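/- Let $\mathbf X=\{0,1\}$, let $\mathbf X^*$ be the set of finite words and $\mathbf X^\infty$ the space of infinite words over $\mathbf X$ (product topology), and for $\alpha\in\mathbf X^*$ let $Z(\alpha)=\{\alpha x: x\in\mathbf X^\infty\}$ and let $|\alpha|$ be the length of $\alpha$. Let $\Gamma=\langle a,b : a^2=b^2=e\rangle$ be the infinite dihedral group, acting on $\mathbf X^\infty$ by the homeomorphisms determined by $$a\cdot(0x)=1x,\qquad a\cdot(1x)=0x,\qquad b\cdot(0x)=0(a\cdot x),\qquad b\cdot(1x)=1(b\cdot x)\qquad(x\in\mathbf X^\infty).$$ For $\alpha,\beta\in\mathbf X^*$ and $g\in\Gamma$ let $S_{(\alpha,g,\beta)}:Z(\beta)\to Z(\alpha)$ be the homeomorphism $\beta x\mapsto\alpha(g\cdot x)$. Let $\mathcal G$ be the étale groupoid of germs of these local homeomorphisms: its arrows are the germs $[\alpha,g,\beta;x]$ of $S_{(\alpha,g,\beta)}$ at points $x\in Z(\beta)$, with source $x$ and range $S_{(\alpha,g,\beta)}(x)$; the product is given by composition of germs; and the topology is generated by the sets $\{[\alpha,g,\beta;x]:x\in U\}$ with $U\subseteq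 Z(\beta)$ open. Its unit space is identified with $\mathbf X^\infty$, and $\mathcal G$ is Hausdorff. Let $c:\mathcal G\to\mathbb Z$ be the continuous cocycle $c([\alpha,g,\beta;x])=|\alpha|-|\beta|$, and let $$\mathcal H:=c^{-1}(0)=\{[\alpha,g,\beta;x]\in\mathcal G:|\alpha|=|\beta|\}.$$ For $n\ge 1$ let $\mathcal H^{(n)}$ be the space of composable strings $(g_1,\dots,g_n)$ of arrows of $\mathcal H$, and let $\mathcal H^{(0)}$ be the unit space. Let $H_*(\mathcal H)$ be the homology of the chain complex $C_c(\mathcal H^{(0)},\mathbb Z)\leftarrow C_c(\mathcal H^{(1)},\mathbb Z)\leftarrow C_c(\mathcal H^{(2)},\mathbb Z)\leftarrow\cdots$ of compactly supported continuous integer-valued functions, with differential $\delta_n=\sum_{i=0}^n(-1)^i (d_i)_*$ for $n\ge1$. Here, for $n\ge2$, the map $d_i:\mathcal H^{(n)}\to\mathcal H^{(n-1)}$ deletes $g_1$ if $i=0$, deletes $g_n$ if $i=n$, and replaces $g_i,g_{i+1}$ by $g_ig_{i+1}$ otherwise; for $n=1$, $d_0$ is the source map and $d_1$ the range map; and $\pi_*f(y)=\sum_{\pi(x)=y}f(x)$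 for a local homeomorphism $\pi$. Then, for every $n\ge1$, $H_{2n}(\mathcal H)=0$ and $H_{2n+1}(\mathcal H)$ is a torsion group. -/

import Mathlib

open Topology CategoryTheory
open scoped CompactlySupported

universe u

/-! ## Push-forward of compactly supported functions -/

section PushForward

variable {X Y Z : Type*} [TopologicalSpace X] [TopologicalSpace Y] [TopologicalSpace Z]

theorem finite_fibre_tsupport {π : X → Y} (hπ : IsLocalHomeomorph π) [T2Space Y]
    (f : C_c(X, ℤ)) (y : Y) : (π ⁻¹' {y} ∩ tsupport f).Finite := by
  have hc : IsCompact (π ⁻¹' {y} ∩ tsupport f) :=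
    f.hasCompactSupport.inter_left (isClosed_singleton.preimage hπ.continuous)
  have hs : (π '' (π ⁻¹' {y} ∩ tsupport f)).Subsingleton := by
    rintro _ ⟨a, ha, rfl⟩ _ ⟨b, hb, rfl⟩
    exact (show π a = y from ha.1).trans (show π b = y from hb.1).symm
  exact hc.finite
    ((hπ.isLocalHomeomorphOn.mono (Set.subset_univ _)).isDiscrete_of_image hs.isDiscrete)

theorem finite_fibre_support {π : X → Y} (hπ : IsLocalHomeomorph π) [T2Space Y]
    (f : C_c(X, ℤ)) (y : Y) : (π ⁻¹' {y} ∩ Function.support f).Finite :=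
  (finite_fibre_tsupport hπ f y).subset (Set.inter_subset_inter_right _ (subset_tsupport f))

theorem pushforward_eventually_eq {π : X → Y} (hπ : IsLocalHomeomorph π) [T2Space X] [T2Space Y]
    (f : C_c(X, ℤ)) (y₀ : Y) :
    ∀ᶠ y in 𝓝 y₀, (∑ᶠ x ∈ π ⁻¹' {y}, f x) = ∑ᶠ x ∈ π ⁻¹' {y₀}, f x := by
  classical
  set T := π ⁻¹' {y₀} ∩ tsupport f with hT
  have hTfin : T.Finite := finite_fibre_tsupport hπ f y₀
  obtain ⟨U, hU, hdisj⟩ := hTfin.t2_separation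
  choose e he hee using hπ
  let W : X → Set X := fun x => U x ∩ (f ⁻¹' {f x} ∩ (e x).source)
  have hWo : ∀ x, IsOpen (W x) := fun x =>
    (hU x).2.inter (((isOpen_discrete _).preimage f.continuous).inter (e x).open_source)
  have hWx : ∀ x, x ∈ W x := fun x => ⟨(hU x).1, rfl, he x⟩
  have hWinj : ∀ x, Set.InjOn π (W x) := by
    intro x a ha b hb hab
    rw [hee x] at hab
    exact (e x).injOn ha.2.2 hb.2.2 hab
  have hπ' : IsLocalHomeomorph π := fun x => ⟨e x, he x, hee x⟩
  have hK : IsCompact (tsupport f \ ⋃ x ∈ T, W x) :=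
    f.hasCompactSupport.diff (isOpen_biUnion fun x _ => hWo x)
  have hKc : IsClosed (π '' (tsupport f \ ⋃ x ∈ T, W x)) := (hK.image hπ'.continuous).isClosed
  have hy0 : y₀ ∉ π '' (tsupport f \ ⋃ x ∈ T, W x) := by
    rintro ⟨x, ⟨hx1, hx2⟩, hx3⟩
    exact hx2 (Set.mem_biUnion (show x ∈ T from ⟨hx3, hx1⟩) (hWx x))
  have hV : ∀ᶠ y in 𝓝 y₀, ∀ x ∈ T, y ∈ π '' W x := by
    rw [Filter.eventually_all_finite hTfin]
    intro x hx
    exact (hπ'.isOpenMap _ (hWo x)).mem_nhds ⟨x, hWx x, hx.1⟩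
  filter_upwards [hV, hKc.isOpen_compl.mem_nhds hy0] with y hy hyK
  have hz : ∀ x, ∃ z, x ∈ T → z ∈ W x ∧ π z = y := by
    intro x
    by_cases hx : x ∈ T
    · obtain ⟨z, hz⟩ := hy x hx
      exact ⟨z, fun _ => hz⟩
    · exact ⟨x, fun h => absurd h hx⟩
  choose z hz using hz
  have hzinj : Set.InjOn z T := by
    intro a ha b hb hab
    by_contra hne
    have h1 := (hz a ha).1.1
    have h2 := (hz b hb).1.1
    rw [← hab] at h2
    exact Set.disjoint_left.1 (hdisj ha hb hne) h1 h2
  have e1 : (∑ᶠ x ∈ π ⁻¹' {y}, f x) = ∑ᶠ x ∈ z '' T, f x := by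
    apply finsum_mem_inter_support_eq
    ext w
    constructor
    · rintro ⟨hw1, hw2⟩
      have hwK : w ∈ ⋃ x ∈ T, W x := by
        by_contra hcon
        exact hyK ⟨w, ⟨subset_tsupport f hw2, hcon⟩, hw1⟩
      obtain ⟨x, hx, hwx⟩ := Set.mem_iUnion₂.1 hwK
      refine ⟨⟨x, hx, ?_⟩, hw2⟩
      exact hWinj x (hz x hx).1 hwx ((hz x hx).2.trans (show π w = y from hw1).symm)
    · rintro ⟨⟨x, hx, rfl⟩, hw2⟩
      exact ⟨(hz x hx).2, hw2⟩
  have e2 : (∑ᶠ x ∈ π ⁻¹' {y₀}, f x) = ∑ᶠ x ∈ T, f x := by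
    apply finsum_mem_inter_support_eq
    ext w
    constructor
    · rintro ⟨hw1, hw2⟩
      exact ⟨⟨hw1, subset_tsupport f hw2⟩, hw2⟩
    · rintro ⟨⟨hw1, _⟩, hw2⟩
      exact ⟨hw1, hw2⟩
  rw [e1, e2, finsum_mem_image hzinj]
  exact finsum_mem_congr rfl fun x hx => (hz x hx).1.2.1

/-- The push-forward `π_* f (y) = ∑_{π(x) = y} f(x)` of a compactly supported continuous function
`f : X → ℤ` along a local homeomorphism `π` of Hausdorff spaces. -/
noncomputable def pushforward [T2Space X] [T2Space Y] (π : X → Y) (hπ : IsLocalHomeomorph π) :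
    C_c(X, ℤ) →ₗ[ℤ] C_c(Y, ℤ) :=
  AddMonoidHom.toIntLinearMap
    { toFun := fun f =>
        { toFun := fun y => ∑ᶠ x ∈ π ⁻¹' {y}, f x
          continuous_toFun := continuous_iff_continuousAt.2 fun y₀ =>
            continuousAt_const.congr
              ((pushforward_eventually_eq hπ f y₀).mono fun _ h => h.symm)
          hasCompactSupport' := by
            refine HasCompactSupport.intro (f.hasCompactSupport.image hπ.continuous) ?_
            intro y hy
            refine finsum_mem_eq_zero_of_forall_eq_zero fun x hx => ?_
            by_contra hne
            exact hy ⟨x, subset_tsupport f hne, hx⟩ }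
      map_zero' := by
        ext y
        exact finsum_mem_eq_zero_of_forall_eq_zero fun x _ => rfl
      map_add' := by
        intro f g
        ext y
        exact finsum_mem_add_distrib' (finite_fibre_support hπ f y) (finite_fibre_support hπ g y) }

theorem pushforward_apply [T2Space X] [T2Space Y] (π : X → Y) (hπ : IsLocalHomeomorph π)
    (f : C_c(X, ℤ)) (y : Y) : pushforward π hπ f y = ∑ᶠ x ∈ π ⁻¹' {y}, f x := rfl

theorem pushforward_comp [T2Space X] [T2Space Y] [T2Space Z] {π : X → Y} {ρ : Y → Z}
    (hπ : IsLocalHomeomorph π) (hρ : IsLocalHomeomorph ρ) {σ : X → Z} (hσ : IsLocalHomeomorph σ)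
    (h : ρ ∘ π = σ) : pushforward ρ hρ ∘ₗ pushforward π hπ = pushforward σ hσ := by
  subst h
  ext f z
  change pushforward ρ hρ (pushforward π hπ f) z = _
  rw [pushforward_apply, pushforward_apply]
  set S := (ρ ∘ π) ⁻¹' {z} ∩ Function.support f with hS
  have hSfin : S.Finite := finite_fibre_support hσ f z
  have e1 : (∑ᶠ x ∈ (ρ ∘ π) ⁻¹' {z}, f x) = ∑ᶠ x ∈ ⋃ y ∈ π '' S, S ∩ π ⁻¹' {y}, f x := by
    apply finsum_mem_inter_support_eq
    ext x
    constructor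
    · rintro ⟨h1, h2⟩
      exact ⟨Set.mem_iUnion₂.2 ⟨π x, ⟨x, ⟨h1, h2⟩, rfl⟩, ⟨h1, h2⟩, rfl⟩, h2⟩
    · rintro ⟨h1, h2⟩
      obtain ⟨y, _, hx, _⟩ := Set.mem_iUnion₂.1 h1
      exact hx
  have e2 : ∀ y ∈ ρ ⁻¹' {z}, pushforward π hπ f y = ∑ᶠ x ∈ S ∩ π ⁻¹' {y}, f x := by
    intro y hy
    rw [pushforward_apply]
    apply finsum_mem_inter_support_eq
    ext x
    constructor
    · rintro ⟨h1, h2⟩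
      refine ⟨⟨⟨?_, h2⟩, h1⟩, h2⟩
      change ρ (π x) = z
      rw [show π x = y from h1]; exact hy
    · rintro ⟨⟨_, h1⟩, h2⟩
      exact ⟨h1, h2⟩
  rw [e1, finsum_mem_biUnion ?_ (hSfin.image π) (fun y _ => hSfin.inter_of_left _),
    finsum_mem_congr rfl e2]
  · apply finsum_mem_inter_support_eq
    ext y
    constructor
    · rintro ⟨_, h2⟩
      refine ⟨?_, h2⟩
      by_contra hcon
      apply h2
      refine finsum_mem_eq_zero_of_forall_eq_zero fun x hx => ?_
      exact absurd ⟨x, hx.1, hx.2⟩ hcon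
    · rintro ⟨⟨x, hx, rfl⟩, h2⟩
      exact ⟨hx.1, h2⟩
  · intro y _ y' _ hne
    refine Set.disjoint_left.2 fun x hx hx' => hne ?_
    exact (show π x = y from hx.2).symm.trans hx'.2

end PushForward

/-! ## Étale groupoids and their homology -/

/-- An étale groupoid with unit space `X` and space of arrows `G`. The product `mul g h` is the
product of the groupoid when `src g = rng h`; its value is irrelevant otherwise. -/
structure EtaleGroupoid (X G : Type*) [TopologicalSpace X] [TopologicalSpace G] where
  src : G → X
  rng : G → X
  unit : X → G
  inv : G → G
  mul : G → G → G
  src_unit : ∀ x, src (unit x) = x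
  rng_unit : ∀ x, rng (unit x) = x
  src_inv : ∀ g, src (inv g) = rng g
  rng_inv : ∀ g, rng (inv g) = src g
  src_mul : ∀ g h, src g = rng h → src (mul g h) = src h
  rng_mul : ∀ g h, src g = rng h → rng (mul g h) = rng g
  mul_assoc : ∀ g h k, src g = rng h → src h = rng k → mul (mul g h) k = mul g (mul h k)
  unit_mul : ∀ g, mul (unit (rng g)) g = g
  mul_unit : ∀ g, mul g (unit (src g)) = g
  inv_mul : ∀ g, mul (inv g) g = unit (src g)
  mul_inv : ∀ g, mul g (inv g) = unit (rng g)
  continuous_unit : Continuous unit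
  continuous_inv : Continuous inv
  continuousOn_mul : ContinuousOn (fun p : G × G => mul p.1 p.2) {p | src p.1 = rng p.2}
  isLocalHomeomorph_src : IsLocalHomeomorph src
  isLocalHomeomorph_rng : IsLocalHomeomorph rng

theorem IsLocalHomeomorph.pullback_snd {A B C : Type*} [TopologicalSpace A] [TopologicalSpace B]
    [TopologicalSpace C] {f : A → C} {g : B → C} (hf : IsLocalHomeomorph f) (hg : Continuous g) :
    IsLocalHomeomorph fun p : {p : A × B // f p.1 = g p.2} => p.1.2 := by
  have hcont : Continuous fun p : {p : A × B // f p.1 = g p.2} => p.1.2 := by fun_prop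
  have hopen : IsOpenMap fun p : {p : A × B // f p.1 = g p.2} => p.1.2 := by
    intro U hU
    rw [isOpen_iff_mem_nhds]
    rintro _ ⟨p, hp, rfl⟩
    obtain ⟨e, he, hfe⟩ := hf p.1.1
    have hD : IsOpen (g ⁻¹' e.target) := e.open_target.preimage hg
    let σ : (g ⁻¹' e.target) → {p : A × B // f p.1 = g p.2} := fun b =>
      ⟨(e.symm (g b), b), by change f (e.symm (g b)) = g b; rw [hfe]; exact e.right_inv b.2⟩
    have hσ : Continuous σ := by
      refine Continuous.subtype_mk (Continuous.prodMk ?_ continuous_subtype_val) _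
      exact e.continuousOn_symm.comp_continuous (hg.comp continuous_subtype_val) fun b => b.2
    have hpD : p.1.2 ∈ g ⁻¹' e.target := by
      change g p.1.2 ∈ e.target
      rw [← p.2, congrFun hfe p.1.1]; exact e.map_source he
    have hσp : σ ⟨p.1.2, hpD⟩ = p := by
      apply Subtype.ext
      refine Prod.ext ?_ rfl
      change e.symm (g p.1.2) = p.1.1
      rw [← p.2, congrFun hfe p.1.1]; exact e.left_inv he
    have h1 : IsOpen (Subtype.val '' (σ ⁻¹' U)) := hD.isOpenMap_subtype_val _ (hU.preimage hσ)
    refine Filter.mem_of_superset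
      (h1.mem_nhds ⟨⟨p.1.2, hpD⟩, by change σ _ ∈ U; rw [hσp]; exact hp, rfl⟩) ?_
    rintro _ ⟨b, hb, rfl⟩
    exact ⟨σ b, hb, rfl⟩
  rw [isLocalHomeomorph_iff_isOpenEmbedding_restrict]
  intro p
  obtain ⟨e, he, hfe⟩ := hf p.1.1
  have hS : IsOpen {p : {p : A × B // f p.1 = g p.2} | p.1.1 ∈ e.source} :=
    e.open_source.preimage (by fun_prop)
  refine ⟨_, hS.mem_nhds he, IsOpenEmbedding.of_continuous_injective_isOpenMap
    (hcont.comp continuous_subtype_val) ?_ (hopen.comp hS.isOpenMap_subtype_val)⟩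
  rintro ⟨q, hq⟩ ⟨q', hq'⟩ h
  have h2 : q.1.2 = q'.1.2 := h
  have h1 : q.1.1 = q'.1.1 := by
    apply e.injOn hq hq'
    rw [← hfe, q.2, q'.2, h2]
  exact Subtype.ext (Subtype.ext (Prod.ext h1 h2))

theorem IsLocalHomeomorph.pullback_fst {A B C : Type*} [TopologicalSpace A] [TopologicalSpace B]
    [TopologicalSpace C] {f : A → C} {g : B → C} (hf : Continuous f) (hg : IsLocalHomeomorph g) :
    IsLocalHomeomorph fun p : {p : A × B // f p.1 = g p.2} => p.1.1 := by
  let Φ : {p : A × B // f p.1 = g p.2} ≃ₜ {p : B × A // g p.1 = f p.2} :=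
    { toFun := fun p => ⟨(p.1.2, p.1.1), p.2.symm⟩
      invFun := fun p => ⟨(p.1.2, p.1.1), p.2.symm⟩
      left_inv := fun _ => rfl
      right_inv := fun _ => rfl
      continuous_toFun := by fun_prop
      continuous_invFun := by fun_prop }
  exact (IsLocalHomeomorph.pullback_snd hg hf).comp Φ.isLocalHomeomorph

namespace EtaleGroupoid

section Strings

variable {X G : Type*} [TopologicalSpace X] [TopologicalSpace G] (𝒢 : EtaleGroupoid X G)

/-- The space `𝒢⁽ⁿ⁾` of composable strings `(g₁, …, gₙ)` of `n` arrows, together with their vertices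
`x₀, …, xₙ`, where `rng gᵢ = xᵢ₋₁` and `src gᵢ = xᵢ`. For `n ≥ 1` the vertices are continuous
functions of the arrows, so that this is the space of composable strings in `Gⁿ`; for `n = 0` this
is the unit space. -/
abbrev Strings (n : ℕ) : Type _ :=
  {p : (Fin (n + 1) → X) × (Fin n → G) //
    ∀ i : Fin n, 𝒢.rng (p.2 i) = p.1 i.castSucc ∧ 𝒢.src (p.2 i) = p.1 i.succ}

variable {𝒢} in
theorem Strings.composable {n : ℕ} (p : 𝒢.Strings (n + 1)) (j : Fin n) :
    𝒢.src (p.1.2 j.castSucc) = 𝒢.rng (p.1.2 j.succ) := by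
  rw [(p.2 _).1, (p.2 _).2]; rfl

/-- The face map `dᵢ : 𝒢⁽ⁿ⁺¹⁾ → 𝒢⁽ⁿ⁾`, which deletes the vertex `xᵢ`: it deletes the first arrow for
`i = 0` and the last one for `i = n + 1`, and replaces `gᵢ, gᵢ₊₁` by `gᵢ gᵢ₊₁` otherwise. -/
def face {n : ℕ} (i : Fin (n + 2)) (p : 𝒢.Strings (n + 1)) : 𝒢.Strings n :=
  ⟨(fun k => p.1.1 (i.succAbove k),
    fun j =>
      if (j : ℕ) + 1 < i then p.1.2 j.castSucc
      else if (j : ℕ) + 1 = i then 𝒢.mul (p.1.2 j.castSucc) (p.1.2 j.succ)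
      else p.1.2 j.succ), by
    intro j
    have hc := p.composable j
    have h1 := p.2 j.castSucc
    have h2 := p.2 j.succ
    dsimp only
    by_cases hlt : (j : ℕ) + 1 < i
    · rw [if_pos hlt, Fin.succAbove_of_castSucc_lt i j.castSucc (by rw [Fin.lt_def]; simp; omega),
        Fin.succAbove_of_castSucc_lt i j.succ (by rw [Fin.lt_def]; simpa using hlt)]
      exact h1
    · rw [if_neg hlt]
      rw [Fin.succAbove_of_le_castSucc i j.succ (by rw [Fin.le_def]; simp; omega)]
      by_cases heq : (j : ℕ) + 1 = i
      · rw [if_pos heq, 𝒢.rng_mul _ _ hc, 𝒢.src_mul _ _ hc,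
          Fin.succAbove_of_castSucc_lt i j.castSucc (by rw [Fin.lt_def]; simp; omega)]
        exact ⟨h1.1, h2.2⟩
      · rw [if_neg heq,
          Fin.succAbove_of_le_castSucc i j.castSucc (by rw [Fin.le_def]; simp; omega)]
        exact h2⟩

theorem continuous_face {n : ℕ} (i : Fin (n + 2)) : Continuous (𝒢.face (n := n) i) := by
  refine Continuous.subtype_mk (Continuous.prodMk ?_ ?_) _
  · exact continuous_pi fun k => by fun_prop
  · refine continuous_pi fun j => ?_
    split_ifs
    · fun_prop
    · exact 𝒢.continuousOn_mul.comp_continuous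
        (f := fun p : 𝒢.Strings (n + 1) => (p.1.2 j.castSucc, p.1.2 j.succ)) (by fun_prop)
        fun p => p.composable j
    · fun_prop

/-- A string of `n + 1` arrows is an arrow followed by a string of `n` arrows. -/
def splitHomeo (n : ℕ) :
    𝒢.Strings (n + 1) ≃ₜ {p : G × 𝒢.Strings n // 𝒢.src p.1 = p.2.1.1 0} where
  toFun p := ⟨(p.1.2 0, ⟨(fun k => p.1.1 k.succ, fun j => p.1.2 j.succ), fun j => p.2 j.succ⟩),
    (p.2 0).2⟩
  invFun p := ⟨(Fin.cons (𝒢.rng p.1.1) p.1.2.1.1, Fin.cons p.1.1 p.1.2.1.2), by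
    intro j
    refine Fin.cases ⟨rfl, p.2⟩ (fun j => ?_) j
    exact p.1.2.2 j⟩
  left_inv p := by
    apply Subtype.ext
    refine Prod.ext (funext fun k => ?_) (funext fun j => ?_)
    · refine Fin.cases ?_ (fun k => ?_) k
      · exact (p.2 0).1
      · rfl
    · refine Fin.cases ?_ (fun k => ?_) j <;> rfl
  right_inv p := rfl
  continuous_toFun := by fun_prop
  continuous_invFun := by
    have := 𝒢.isLocalHomeomorph_rng.continuous
    refine Continuous.subtype_mk (Continuous.prodMk ?_ ?_) _
    · refine continuous_pi fun k => Fin.cases ?_ (fun k => ?_) k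
      · simp only [Fin.cons_zero]; fun_prop
      · simp only [Fin.cons_succ]; fun_prop
    · refine continuous_pi fun k => Fin.cases ?_ (fun k => ?_) k
      · simp only [Fin.cons_zero]; fun_prop
      · simp only [Fin.cons_succ]; fun_prop

/-- A string of length zero is a unit. -/
def zeroHomeo : 𝒢.Strings 0 ≃ₜ X where
  toFun p := p.1.1 0
  invFun x := ⟨(fun _ => x, Fin.elim0), fun i => i.elim0⟩
  left_inv p := by
    apply Subtype.ext
    refine Prod.ext (funext fun k => ?_) (funext fun j => j.elim0)
    obtain rfl : k = 0 := by omega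
    rfl
  right_inv x := rfl
  continuous_toFun := by fun_prop
  continuous_invFun := by
    refine Continuous.subtype_mk (Continuous.prodMk (by fun_prop) ?_) _
    exact continuous_pi fun j => j.elim0

theorem isLocalHomeomorph_first (n : ℕ) :
    IsLocalHomeomorph fun p : 𝒢.Strings n => p.1.1 0 := by
  induction n with
  | zero => exact 𝒢.zeroHomeo.isLocalHomeomorph
  | succ n ih =>
    have h := 𝒢.isLocalHomeomorph_rng.comp
      ((IsLocalHomeomorph.pullback_fst 𝒢.isLocalHomeomorph_src.continuous ih).comp
        (𝒢.splitHomeo n).isLocalHomeomorph)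
    convert h using 1
    funext p
    exact (p.2 0).1.symm

theorem isLocalHomeomorph_last (n : ℕ) :
    IsLocalHomeomorph fun p : 𝒢.Strings n => p.1.1 (Fin.last n) := by
  induction n with
  | zero => exact 𝒢.zeroHomeo.isLocalHomeomorph
  | succ n ih =>
    exact ih.comp ((IsLocalHomeomorph.pullback_snd 𝒢.isLocalHomeomorph_src
      (𝒢.isLocalHomeomorph_first n).continuous).comp (𝒢.splitHomeo n).isLocalHomeomorph)

theorem isLocalHomeomorph_face {n : ℕ} (i : Fin (n + 2)) :
    IsLocalHomeomorph (𝒢.face (n := n) i) := by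
  by_cases hi : i = Fin.last (n + 1)
  · refine IsLocalHomeomorph.of_comp ?_ (𝒢.isLocalHomeomorph_first n) (𝒢.continuous_face i)
    convert 𝒢.isLocalHomeomorph_first (n + 1) using 1
    funext p
    subst hi
    change p.1.1 ((Fin.last (n + 1)).succAbove 0) = _
    rw [Fin.succAbove_last]; rfl
  · refine IsLocalHomeomorph.of_comp ?_ (𝒢.isLocalHomeomorph_last n) (𝒢.continuous_face i)
    convert 𝒢.isLocalHomeomorph_last (n + 1) using 1
    funext p
    change p.1.1 (i.succAbove (Fin.last n)) = _
    rw [Fin.succAbove_ne_last_last hi]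

theorem face_face {n : ℕ} {i j : Fin (n + 2)} (hij : i ≤ j) :
    𝒢.face (n := n) i ∘ 𝒢.face j.succ = 𝒢.face j ∘ 𝒢.face i.castSucc := by
  have hij' : (i : ℕ) ≤ j := hij
  funext p
  apply Subtype.ext
  refine Prod.ext (funext fun k => ?_) (funext fun k => ?_)
  · change p.1.1 (j.succ.succAbove (i.succAbove k)) = p.1.1 (i.castSucc.succAbove (j.succAbove k))
    simp only [Fin.succAbove, Fin.lt_def]
    grind
  · have hc1 := p.composable k.castSucc
    have hc2 := p.composable k.succ
    have hassoc := 𝒢.mul_assoc _ _ _ hc1 hc2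
    simp only [Function.comp, face, Fin.val_castSucc, Fin.val_succ]
    split_ifs <;> first | omega | rfl | exact hassoc | exact hassoc.symm

end Strings

section Homology

variable {X G : Type u} [TopologicalSpace X] [TopologicalSpace G] (𝒢 : EtaleGroupoid X G)
  [T2Space X] [T2Space G]

/-- The group `C_c(𝒢⁽ⁿ⁾, ℤ)`. -/
abbrev chains (n : ℕ) : ModuleCat.{u} ℤ := ModuleCat.of ℤ C_c(𝒢.Strings n, ℤ)

/-- The homomorphism `dᵢ_* : C_c(𝒢⁽ⁿ⁺¹⁾, ℤ) → C_c(𝒢⁽ⁿ⁾, ℤ)`. -/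
noncomputable def chainFace {n : ℕ} (i : Fin (n + 2)) : 𝒢.chains (n + 1) ⟶ 𝒢.chains n :=
  ModuleCat.ofHom (pushforward (𝒢.face i) (𝒢.isLocalHomeomorph_face i))

/-- The differential `∑ᵢ (-1)ⁱ dᵢ_* : C_c(𝒢⁽ⁿ⁺¹⁾, ℤ) → C_c(𝒢⁽ⁿ⁾, ℤ)`. -/
noncomputable def boundary (n : ℕ) : 𝒢.chains (n + 1) ⟶ 𝒢.chains n :=
  ∑ i : Fin (n + 2), (-1 : ℤ) ^ (i : ℕ) • 𝒢.chainFace i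

theorem chainFace_comp {n : ℕ} {i j : Fin (n + 2)} (hij : i ≤ j) :
    𝒢.chainFace j.succ ≫ 𝒢.chainFace i = 𝒢.chainFace i.castSucc ≫ 𝒢.chainFace (n := n) j := by
  have h : IsLocalHomeomorph (𝒢.face (n := n) i ∘ 𝒢.face j.succ) :=
    (𝒢.isLocalHomeomorph_face i).comp (𝒢.isLocalHomeomorph_face j.succ)
  simp only [chainFace, ← ModuleCat.ofHom_comp]
  rw [pushforward_comp _ _ h rfl, pushforward_comp _ _ h (𝒢.face_face hij).symm]

theorem boundary_boundary (n : ℕ) : 𝒢.boundary (n + 1) ≫ 𝒢.boundary n = 0 := by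
  simp only [boundary, Preadditive.comp_sum, Preadditive.sum_comp, ← Finset.sum_product']
  let P := Fin (n + 2) × Fin (n + 3)
  let S : Finset P := {ij : P | (ij.2 : ℕ) ≤ (ij.1 : ℕ)}
  rw [Finset.univ_product_univ, ← Finset.sum_add_sum_compl S, ← eq_neg_iff_add_eq_zero,
    ← Finset.sum_neg_distrib]
  let φ : ∀ ij : P, ij ∈ S → P := fun ij hij =>
    (Fin.castLT ij.2 (lt_of_le_of_lt (Finset.mem_filter.mp hij).right (Fin.is_lt ij.1)), ij.1.succ)
  apply Finset.sum_bij φ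
  · intro ij hij
    simp_rw [S, φ, Finset.compl_filter, Finset.mem_filter_univ, Fin.val_succ,
      Fin.val_castLT] at hij ⊢
    lia
  · rintro ⟨i, j⟩ hij ⟨i', j'⟩ hij' h
    rw [Prod.mk_inj]
    exact ⟨by simpa [φ] using! congr_arg Prod.snd h,
      by simpa [φ, Fin.castSucc_castLT] using! congr_arg Fin.castSucc (congr_arg Prod.fst h)⟩
  · rintro ⟨i', j'⟩ hij'
    simp_rw [S, Finset.compl_filter, Finset.mem_filter_univ, not_le] at hij'
    refine ⟨(j'.pred <| ?_, Fin.castSucc i'), ?_, ?_⟩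
    · rintro rfl
      simp only [Fin.val_zero, not_lt_zero] at hij'
    · simpa [S] using! Nat.le_sub_one_of_lt hij'
    · simp only [φ, Fin.castLT_castSucc, Fin.succ_pred]
  · rintro ⟨i, j⟩ hij
    dsimp
    simp only [Preadditive.zsmul_comp, Preadditive.comp_zsmul, smul_smul, ← neg_smul]
    congr 1
    · simp only [φ, Fin.val_succ, pow_add, pow_one, mul_neg, neg_neg, mul_one]
      apply mul_comm
    · have hij2 : (j : ℕ) ≤ i := by simpa [S] using! hij
      exact (𝒢.chainFace_comp (i := j.castLT (lt_of_le_of_lt hij2 i.2)) (j := i) hij2).symm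

/-- The chain complex `0 ← C_c(𝒢⁽⁰⁾, ℤ) ← C_c(𝒢⁽¹⁾, ℤ) ← C_c(𝒢⁽²⁾, ℤ) ← ⋯`. -/
noncomputable def chainComplex : ChainComplex (ModuleCat.{u} ℤ) ℕ :=
  ChainComplex.of 𝒢.chains 𝒢.boundary 𝒢.boundary_boundary

/-- The homology group `H_n(𝒢)` of a Hausdorff étale groupoid, with integer coefficients. -/
noncomputable abbrev homology (n : ℕ) : ModuleCat.{u} ℤ := 𝒢.chainComplex.homology n

end Homology

end EtaleGroupoid

open Classical in
/-- The subgroupoid `c⁻¹(0)` of an étale groupoid, for a continuous cocycle `c : 𝒢 → ℤ`. It is open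
and has the same unit space as `𝒢`. -/
noncomputable def EtaleGroupoid.cocycleKer {X G : Type*} [TopologicalSpace X] [TopologicalSpace G]
    (𝒢 : EtaleGroupoid X G) (c : G → ℤ)
    (hmul : ∀ g h, 𝒢.src g = 𝒢.rng h → c (𝒢.mul g h) = c g + c h) (hc : Continuous c) :
    EtaleGroupoid X {g : G // c g = 0} :=
  have hunit : ∀ x, c (𝒢.unit x) = 0 := fun x => by
    have h := hmul (𝒢.unit x) (𝒢.unit x) (by rw [𝒢.src_unit, 𝒢.rng_unit])
    have h2 := 𝒢.mul_unit (𝒢.unit x)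
    rw [𝒢.src_unit] at h2
    rw [h2] at h
    omega
  have hinv : ∀ g, c g = 0 → c (𝒢.inv g) = 0 := fun g hg => by
    have h := hmul (𝒢.inv g) g (𝒢.src_inv g)
    rw [𝒢.inv_mul, hunit, hg] at h
    omega
  have hopen : IsOpen {g : G | c g = 0} := (isOpen_discrete {(0 : ℤ)}).preimage hc
  { src := fun g => 𝒢.src g
    rng := fun g => 𝒢.rng g
    unit := fun x => ⟨𝒢.unit x, hunit x⟩
    inv := fun g => ⟨𝒢.inv g, hinv g g.2⟩
    mul := fun g h =>
      if hgh : 𝒢.src g = 𝒢.rng h then ⟨𝒢.mul g h, by rw [hmul _ _ hgh, g.2, h.2]; rfl⟩ else g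
    src_unit := 𝒢.src_unit
    rng_unit := 𝒢.rng_unit
    src_inv := fun g => 𝒢.src_inv g
    rng_inv := fun g => 𝒢.rng_inv g
    src_mul := fun g h hgh => by rw [dif_pos hgh]; exact 𝒢.src_mul _ _ hgh
    rng_mul := fun g h hgh => by rw [dif_pos hgh]; exact 𝒢.rng_mul _ _ hgh
    mul_assoc := fun g h k hgh hhk => by
      apply Subtype.ext
      have h1 : 𝒢.src (𝒢.mul g h) = 𝒢.rng k := (𝒢.src_mul _ _ hgh).trans hhk
      have h2 : 𝒢.src g = 𝒢.rng (𝒢.mul h k) := hgh.trans (𝒢.rng_mul _ _ hhk).symm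
      simp only [dif_pos hgh, dif_pos hhk, dif_pos h1, dif_pos h2]
      exact 𝒢.mul_assoc _ _ _ hgh hhk
    unit_mul := fun g => by
      apply Subtype.ext
      rw [dif_pos (𝒢.src_unit _)]
      exact 𝒢.unit_mul g
    mul_unit := fun g => by
      apply Subtype.ext
      rw [dif_pos (𝒢.rng_unit _).symm]
      exact 𝒢.mul_unit g
    inv_mul := fun g => by
      apply Subtype.ext
      rw [dif_pos (𝒢.src_inv _)]
      exact 𝒢.inv_mul g
    mul_inv := fun g => by
      apply Subtype.ext
      rw [dif_pos (𝒢.rng_inv _).symm]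
      exact 𝒢.mul_inv g
    continuous_unit := 𝒢.continuous_unit.subtype_mk _
    continuous_inv := (𝒢.continuous_inv.comp continuous_subtype_val).subtype_mk _
    continuousOn_mul := by
      have hi : IsInducing (Subtype.val : {g : G // c g = 0} → G) := IsInducing.subtypeVal
      rw [hi.continuousOn_iff]
      have h : ContinuousOn (fun p : {g : G // c g = 0} × {g : G // c g = 0} =>
          𝒢.mul p.1.1 p.2.1) {p | 𝒢.src p.1.1 = 𝒢.rng p.2.1} :=
        𝒢.continuousOn_mul.comp (f := fun p : {g : G // c g = 0} × {g : G // c g = 0} =>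
          (p.1.1, p.2.1)) (by fun_prop) fun p hp => hp
      refine h.congr fun p hp => ?_
      have hp' : 𝒢.src p.1.1 = 𝒢.rng p.2.1 := hp
      simp only [Function.comp]
      rw [dif_pos hp']
    isLocalHomeomorph_src :=
      𝒢.isLocalHomeomorph_src.comp hopen.isOpenEmbedding_subtypeVal.isLocalHomeomorph
    isLocalHomeomorph_rng :=
      𝒢.isLocalHomeomorph_rng.comp hopen.isOpenEmbedding_subtypeVal.isLocalHomeomorph }

namespace DihedralGroupoid

/-! ## Words over the alphabet `{0, 1}` -/

/-- The space `X^∞` of infinite words `x₀ x₁ x₂ …` in the alphabet `X = {0, 1}`, with the product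
topology of the discrete topologies; the cylinder sets `cyl α` form a basis. -/
abbrev InfWord : Type := ℕ → Fin 2

/-- The word `c x₀ x₁ …`. -/
def consWord (c : Fin 2) (x : InfWord) : InfWord
  | 0 => c
  | n + 1 => x n

/-- The concatenation `α x` of a finite word `α ∈ X^*` and an infinite word `x`. -/
def prepend : List (Fin 2) → InfWord → InfWord
  | [], x => x
  | c :: α, x => consWord c (prepend α x)

/-- The infinite word obtained by deleting the first `k` letters. -/
def dropWord (k : ℕ) (x : InfWord) : InfWord := fun n => x (k + n)

/-- The cylinder set `Z(α) = {α x : x ∈ X^∞}`. -/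
def cyl (α : List (Fin 2)) : Set InfWord := Set.range (prepend α)

theorem consWord_injective (c : Fin 2) : Function.Injective (consWord c) := by
  intro x y h
  funext n
  exact congrFun h (n + 1)

theorem consWord_inj {c d : Fin 2} {x y : InfWord} (h : consWord c x = consWord d y) :
    c = d ∧ x = y := by
  have h0 : c = d := congrFun h 0
  subst h0
  exact ⟨rfl, consWord_injective c h⟩

theorem consWord_head_tail (x : InfWord) : consWord (x 0) (dropWord 1 x) = x := by
  funext n
  cases n with
  | zero => rfl
  | succ n => simp [consWord, dropWord, Nat.add_comm]

theorem prepend_append (α γ : List (Fin 2)) (x : InfWord) :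
    prepend (α ++ γ) x = prepend α (prepend γ x) := by
  induction α with
  | nil => rfl
  | cons c α ih => simp [prepend, ih]

theorem prepend_injective (α : List (Fin 2)) : Function.Injective (prepend α) := by
  induction α with
  | nil => exact fun _ _ h => h
  | cons c α ih => exact fun x y h => ih (consWord_injective c h)

theorem prepend_eq_prepend {α α' : List (Fin 2)} (hl : α.length = α'.length) {x y : InfWord}
    (h : prepend α x = prepend α' y) : α = α' ∧ x = y := by
  induction α generalizing α' with
  | nil =>
    cases α' with
    | nil => exact ⟨rfl, h⟩
    | cons => simp at hl
  | cons c α ih =>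
    cases α' with
    | nil => simp at hl
    | cons c' α' =>
      obtain ⟨h1, h2⟩ := consWord_inj h
      obtain ⟨h3, h4⟩ := ih (by simpa using hl) h2
      exact ⟨by rw [h1, h3], h4⟩

theorem dropWord_prepend (α : List (Fin 2)) (x : InfWord) :
    dropWord α.length (prepend α x) = x := by
  induction α with
  | nil => funext n; simp [dropWord, prepend]
  | cons c α ih =>
    refine Eq.trans ?_ ih
    funext n
    simp [dropWord, prepend, consWord, Nat.add_right_comm]

theorem prepend_take (k : ℕ) (x : InfWord) :
    ∃ α : List (Fin 2), α.length = k ∧ prepend α (dropWord k x) = x := by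
  induction k generalizing x with
  | zero => exact ⟨[], rfl, by funext n; simp [prepend, dropWord]⟩
  | succ k ih =>
    obtain ⟨α, hα, h⟩ := ih (dropWord 1 x)
    refine ⟨x 0 :: α, by simp [hα], ?_⟩
    have : dropWord k (dropWord 1 x) = dropWord (k + 1) x := by
      funext n; simp [dropWord]; congr 1; omega
    rw [this] at h
    rw [prepend, h, consWord_head_tail]

theorem continuous_dropWord (k : ℕ) : Continuous (dropWord k) :=
  continuous_pi fun n => continuous_apply (k + n)

theorem continuous_consWord (c : Fin 2) : Continuous (consWord c) := by
  refine continuous_pi fun n => ?_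
  cases n with
  | zero => exact continuous_const
  | succ n => exact continuous_apply n

theorem continuous_prepend (α : List (Fin 2)) : Continuous (prepend α) := by
  induction α with
  | nil => exact continuous_id
  | cons c α ih => exact (continuous_consWord c).comp ih

theorem isOpen_cyl (α : List (Fin 2)) : IsOpen (cyl α) := by
  induction α with
  | nil =>
    have : cyl [] = Set.univ := Set.range_id
    rw [this]; exact isOpen_univ
  | cons c α ih =>
    have : cyl (c :: α) = (fun x : InfWord => x 0) ⁻¹' {c} ∩ dropWord 1 ⁻¹' cyl α := by
      ext x
      constructor
      · rintro ⟨y, rfl⟩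
        refine ⟨rfl, y, ?_⟩
        funext n
        simp [dropWord, prepend, consWord, Nat.add_comm 1 n]
      · rintro ⟨h1, y, hy⟩
        refine ⟨y, ?_⟩
        rw [prepend, hy, ← (show x 0 = c from h1), consWord_head_tail]
    rw [this]
    exact ((isOpen_discrete _).preimage (continuous_apply 0)).inter
      (ih.preimage (continuous_dropWord 1))

/-! ## The self-similar infinite dihedral group -/

/-- The two generators of the infinite dihedral group. -/
inductive Gen : Type
  | a : Gen
  | b : Gen

/-- The relations `a² = e` and `b² = e`. -/
def dihedralRels : Set (FreeGroup Gen) := {FreeGroup.of Gen.a ^ 2, FreeGroup.of Gen.b ^ 2}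

/-- The infinite dihedral group `Γ = ⟨a, b : a² = b² = e⟩`. -/
abbrev Dinf : Type := PresentedGroup dihedralRels

/-- The elements `e`, `a`, `b` of `Γ`, which are permuted by taking restrictions to letters. -/
inductive Nucleus : Type
  | e : Nucleus
  | a : Nucleus
  | b : Nucleus

instance : TopologicalSpace Nucleus := ⊥

instance : DiscreteTopology Nucleus := ⟨rfl⟩

/-- The self-similarity relations
`a·0 = 1·e`, `a·1 = 0·e`, `b·0 = 0·a`, `b·1 = 1·b` (and `e·x = x·e`):
`step s x = (y, t)` means `s·x = y·t`, that is, `s(x w) = y t(w)`. -/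
def step : Nucleus → Fin 2 → Fin 2 × Nucleus
  | .e, x => (x, .e)
  | .a, 0 => (1, .e)
  | .a, 1 => (0, .e)
  | .b, 0 => (0, .a)
  | .b, 1 => (1, .b)

/-- The successive restrictions `s₀ = s`, `sₙ₊₁ = (sₙ)|_{xₙ}` of `s` along the word `x`. -/
def restr (s : Nucleus) (x : InfWord) : ℕ → Nucleus
  | 0 => s
  | n + 1 => (step (restr s x n) (x n)).2

/-- The action of `e`, `a`, `b` on infinite words: `s · x₀ x₁ x₂ … = y₀ y₁ y₂ …` where
`sₙ · xₙ = yₙ · sₙ₊₁` and `s₀ = s`. -/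
def run (s : Nucleus) (x : InfWord) : InfWord := fun n => (step (restr s x n) (x n)).1

theorem step_step (s : Nucleus) (c : Fin 2) : step s (step s c).1 = (c, (step s c).2) := by
  cases s <;> fin_cases c <;> rfl

theorem restr_run (s : Nucleus) (x : InfWord) (n : ℕ) : restr s (run s x) n = restr s x n := by
  induction n with
  | zero => rfl
  | succ n ih => rw [restr, restr, ih, run, step_step]

theorem run_run (s : Nucleus) (x : InfWord) : run s (run s x) = x := by
  funext n
  change (step (restr s (run s x) n) (run s x n)).1 = x n
  rw [restr_run, run, step_step]

theorem restr_consWord (s : Nucleus) (c : Fin 2) (x : InfWord) (n : ℕ) :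
    restr s (consWord c x) (n + 1) = restr (step s c).2 x n := by
  induction n with
  | zero => rfl
  | succ n ih => rw [restr, ih]; rfl

theorem run_consWord (s : Nucleus) (c : Fin 2) (x : InfWord) :
    run s (consWord c x) = consWord (step s c).1 (run (step s c).2 x) := by
  funext n
  cases n with
  | zero => rfl
  | succ n =>
    change (step (restr s (consWord c x) (n + 1)) (x n)).1 = _
    rw [restr_consWord]; rfl

theorem run_e (x : InfWord) : run .e x = x := by
  have h : ∀ n, restr .e x n = .e := by
    intro n
    induction n with
    | zero => rfl
    | succ n ih => rw [restr, ih]; rfl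
  funext n
  rw [run, h]; rfl

theorem continuous_restr (s : Nucleus) (n : ℕ) : Continuous fun x => restr s x n := by
  induction n with
  | zero => exact continuous_const
  | succ n ih =>
    exact (continuous_of_discreteTopology (f := fun p : Nucleus × Fin 2 => (step p.1 p.2).2)).comp
      (ih.prodMk (continuous_apply n))

theorem continuous_run (s : Nucleus) : Continuous (run s) :=
  continuous_pi fun n =>
    (continuous_of_discreteTopology (f := fun p : Nucleus × Fin 2 => (step p.1 p.2).1)).comp
      ((continuous_restr s n).prodMk (continuous_apply n))

/-- The homeomorphism of `X^∞` given by `e`, `a` or `b`. -/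
def runHomeo (s : Nucleus) : InfWord ≃ₜ InfWord where
  toFun := run s
  invFun := run s
  left_inv := run_run s
  right_inv := run_run s
  continuous_toFun := continuous_run s
  continuous_invFun := continuous_run s

/-- The homeomorphisms by which the generators act. -/
def genHomeo : Gen → (InfWord ≃ₜ InfWord)
  | .a => runHomeo .a
  | .b => runHomeo .b

theorem genHomeo_mul_self (i : Gen) : genHomeo i * genHomeo i = 1 := by
  cases i <;> exact Homeomorph.ext fun x => run_run _ x

theorem genHomeo_rels : ∀ r ∈ dihedralRels, FreeGroup.lift genHomeo r = 1 := by
  rintro r (rfl | rfl) <;> simp [pow_two, genHomeo_mul_self]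

/-- The action of `Γ` on `X^∞` by homeomorphisms. -/
def act : Dinf →* (InfWord ≃ₜ InfWord) := PresentedGroup.toGroup genHomeo_rels

theorem act_mul_apply (g h : Dinf) (x : InfWord) : act (g * h) x = act g (act h x) := by
  rw [map_mul]; rfl

theorem act_inv_apply (g : Dinf) (x : InfWord) : act g⁻¹ (act g x) = x := by
  rw [← act_mul_apply, inv_mul_cancel, map_one]; rfl

theorem act_apply_inv (g : Dinf) (x : InfWord) : act g (act g⁻¹ x) = x := by
  rw [← act_mul_apply, mul_inv_cancel, map_one]; rfl

theorem act_of (i : Gen) : act (PresentedGroup.of i) = genHomeo i :=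
  PresentedGroup.toGroup.of genHomeo_rels

theorem act_a_zero (x : InfWord) : act (.of .a) (consWord 0 x) = consWord 1 x := by
  rw [act_of]; exact (run_consWord .a 0 x).trans (by rw [step, run_e])

theorem act_a_one (x : InfWord) : act (.of .a) (consWord 1 x) = consWord 0 x := by
  rw [act_of]; exact (run_consWord .a 1 x).trans (by rw [step, run_e])

theorem act_b_zero (x : InfWord) :
    act (.of .b) (consWord 0 x) = consWord 0 (act (.of .a) x) := by
  rw [act_of, act_of]; exact run_consWord .b 0 x

theorem act_b_one (x : InfWord) :
    act (.of .b) (consWord 1 x) = consWord 1 (act (.of .b) x) := by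
  rw [act_of]; exact run_consWord .b 1 x

theorem act_letter (g : Dinf) (c : Fin 2) :
    ∃ (d : Fin 2) (h : Dinf), ∀ x, act g (consWord c x) = consWord d (act h x) := by
  have hg : g ∈ (⊤ : Subgroup Dinf) := trivial
  rw [← PresentedGroup.closure_range_of] at hg
  induction hg using Subgroup.closure_induction generalizing c with
  | mem g hg =>
    obtain ⟨i, rfl⟩ := hg
    cases i
    · obtain rfl | rfl : c = 0 ∨ c = 1 := by omega
      · exact ⟨1, 1, fun x => by rw [act_a_zero, map_one]; rfl⟩
      · exact ⟨0, 1, fun x => by rw [act_a_one, map_one]; rfl⟩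
    · obtain rfl | rfl : c = 0 ∨ c = 1 := by omega
      · exact ⟨0, .of .a, act_b_zero⟩
      · exact ⟨1, .of .b, act_b_one⟩
  | one => exact ⟨c, 1, fun x => by rw [map_one]; rfl⟩
  | mul g g' _ _ ih ih' =>
    obtain ⟨d, h, H⟩ := ih' c
    obtain ⟨d', h', H'⟩ := ih d
    exact ⟨d', h' * h, fun x => by rw [act_mul_apply, H, H', act_mul_apply]⟩
  | inv g _ ih =>
    have key : ∃ d h, ∀ x, act g (consWord d x) = consWord c (act h x) := by
      obtain ⟨d₀, h₀, H₀⟩ := ih 0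
      obtain ⟨d₁, h₁, H₁⟩ := ih 1
      by_cases h0 : d₀ = c
      · exact ⟨0, h₀, fun x => by rw [H₀, h0]⟩
      by_cases h1 : d₁ = c
      · exact ⟨1, h₁, fun x => by rw [H₁, h1]⟩
      exfalso
      have hd : d₀ = d₁ := by omega
      have e : act g (consWord 0 (act h₀⁻¹ 0)) = act g (consWord 1 (act h₁⁻¹ 0)) := by
        rw [H₀, H₁, act_apply_inv, act_apply_inv, hd]
      have := (consWord_inj ((act g).injective e)).1
      omega
    obtain ⟨d, h, H⟩ := key
    refine ⟨d, h⁻¹, fun x => ?_⟩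
    rw [← act_inv_apply g (consWord d _), H, act_apply_inv]

/-- Self-similarity: for every `g ∈ Γ` and every finite word `γ` there are a word `γ' = g·γ` of the
same length and `h = g|_γ ∈ Γ` with `g·(γ x) = γ' (h·x)` for all `x`. -/
theorem act_prepend (g : Dinf) (γ : List (Fin 2)) :
    ∃ (γ' : List (Fin 2)) (h : Dinf), γ'.length = γ.length ∧
      ∀ x, act g (prepend γ x) = prepend γ' (act h x) := by
  induction γ generalizing g with
  | nil => exact ⟨[], g, rfl, fun x => rfl⟩
  | cons c γ ih =>
    obtain ⟨d, h, H⟩ := act_letter g c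
    obtain ⟨γ', k, hl, K⟩ := ih h
    exact ⟨d :: γ', k, by simp [hl], fun x => by rw [prepend, H, K]; rfl⟩

/-! ## Pseudo-freeness -/

/-- The product `a b`, as a homeomorphism. -/
def rot : InfWord ≃ₜ InfWord := act (.of .a) * act (.of .b)

theorem actA_sq : act (.of .a) * act (.of .a) = 1 := by
  rw [act_of]; exact genHomeo_mul_self _

theorem actB_sq : act (.of .b) * act (.of .b) = 1 := by
  rw [act_of]; exact genHomeo_mul_self _

theorem actA_inv : (act (.of .a))⁻¹ = act (.of .a) := inv_eq_of_mul_eq_one_right actA_sq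

theorem actB_inv : (act (.of .b))⁻¹ = act (.of .b) := inv_eq_of_mul_eq_one_right actB_sq

theorem actA_conj (n : ℤ) : act (.of .a) * rot ^ n = rot ^ (-n) * act (.of .a) := by
  have h : SemiconjBy (act (.of .a)) rot rot⁻¹ := by
    rw [SemiconjBy, rot, mul_inv_rev, actA_inv, actB_inv, mul_assoc, actA_sq, ← mul_assoc, actA_sq,
      one_mul, mul_one]
  have h2 := h.zpow_right n
  rwa [inv_zpow'] at h2

theorem act_eq (g : Dinf) : ∃ n : ℤ, act g = rot ^ n ∨ act g = rot ^ n * act (.of .a) := by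
  have hA : ∀ f : InfWord ≃ₜ InfWord, (∃ n : ℤ, f = rot ^ n ∨ f = rot ^ n * act (.of .a)) →
      ∃ n : ℤ, act (.of .a) * f = rot ^ n ∨ act (.of .a) * f = rot ^ n * act (.of .a) := by
    rintro f ⟨n, rfl | rfl⟩
    · exact ⟨-n, Or.inr (actA_conj n)⟩
    · exact ⟨-n, Or.inl (by rw [← mul_assoc, actA_conj, mul_assoc, actA_sq, mul_one])⟩
  have hR : ∀ f : InfWord ≃ₜ InfWord, (∃ n : ℤ, f = rot ^ n ∨ f = rot ^ n * act (.of .a)) →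
      ∃ n : ℤ, rot * f = rot ^ n ∨ rot * f = rot ^ n * act (.of .a) := by
    rintro f ⟨n, rfl | rfl⟩
    · exact ⟨1 + n, Or.inl (by rw [zpow_add, zpow_one])⟩
    · exact ⟨1 + n, Or.inr (by rw [zpow_add, zpow_one, mul_assoc])⟩
  have hB : act (.of .b) = act (.of .a) * rot := by
    rw [rot, ← mul_assoc, actA_sq, one_mul]
  have hg : g ∈ (⊤ : Subgroup Dinf) := trivial
  rw [← PresentedGroup.closure_range_of] at hg
  induction hg using Subgroup.closure_induction_left with
  | one => exact ⟨0, Or.inl (by simp)⟩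
  | mul_left x hx y _ ih =>
    obtain ⟨i, rfl⟩ := hx
    cases i
    · rw [map_mul]; exact hA _ ih
    · rw [map_mul, hB, mul_assoc]; exact hA _ (hR _ ih)
  | inv_mul_cancel x hx y _ ih =>
    obtain ⟨i, rfl⟩ := hx
    cases i
    · rw [map_mul, map_inv, actA_inv]; exact hA _ ih
    · rw [map_mul, map_inv, actB_inv, hB, mul_assoc]; exact hA _ (hR _ ih)

theorem rot_zero (x : InfWord) : rot (consWord 0 x) = consWord 1 (act (.of .a) x) := by
  change act (.of .a) (act (.of .b) (consWord 0 x)) = _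
  rw [act_b_zero, act_a_zero]

theorem rot_one (x : InfWord) : rot (consWord 1 x) = consWord 0 (act (.of .b) x) := by
  change act (.of .a) (act (.of .b) (consWord 1 x)) = _
  rw [act_b_one, act_a_one]

theorem rot_apply_zero (x : InfWord) : rot x 0 ≠ x 0 := by
  rw [← consWord_head_tail x]
  obtain h | h : x 0 = 0 ∨ x 0 = 1 := by omega
  · rw [h, rot_zero]; simp [consWord]
  · rw [h, rot_one]; simp [consWord]

theorem rot_inv : rot⁻¹ = act (.of .b) * act (.of .a) := by
  rw [rot, mul_inv_rev, actA_inv, actB_inv]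

theorem rot_sq_zero (x : InfWord) : (rot * rot) (consWord 0 x) = consWord 0 (rot⁻¹ x) := by
  change rot (rot (consWord 0 x)) = _
  rw [rot_zero, rot_one, rot_inv]; rfl

theorem rot_sq_one (x : InfWord) : (rot * rot) (consWord 1 x) = consWord 1 (rot x) := by
  change rot (rot (consWord 1 x)) = _
  rw [rot_one, rot_zero]; rfl

theorem zpow_consWord {f h : InfWord ≃ₜ InfWord} {c : Fin 2}
    (H : ∀ x, f (consWord c x) = consWord c (h x)) (n : ℤ) (x : InfWord) :
    (f ^ n) (consWord c x) = consWord c ((h ^ n) x) := by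
  have hn : ∀ (n : ℕ) (x : InfWord), (f ^ n) (consWord c x) = consWord c ((h ^ n) x) := by
    intro n
    induction n with
    | zero => intro x; rfl
    | succ n ih =>
      intro x
      rw [pow_succ, pow_succ]
      change (f ^ n) (f (consWord c x)) = consWord c ((h ^ n) (h x))
      rw [H, ih]
  cases n with
  | ofNat n => simpa using hn n x
  | negSucc n =>
    rw [zpow_negSucc, zpow_negSucc]
    apply (f ^ (n + 1)).injective
    change (f ^ (n + 1) * (f ^ (n + 1))⁻¹) _ = _
    rw [hn, mul_inv_cancel]
    change _ = consWord c ((h ^ (n + 1) * (h ^ (n + 1))⁻¹) x)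
    rw [mul_inv_cancel]; rfl

/-- The nontrivial powers of `a b` have no fixed point. -/
theorem rot_zpow_free (N : ℕ) : ∀ (n : ℤ) (x : InfWord), n.natAbs ≤ N → (rot ^ n) x = x →
    n = 0 := by
  induction N with
  | zero => intro n x hn _; omega
  | succ N ih =>
    intro n x hn hx
    by_contra h0
    obtain ⟨k, rfl | rfl⟩ := Int.even_or_odd' n
    · have hk : rot ^ (2 * k) = (rot * rot) ^ k := by rw [zpow_mul, zpow_ofNat, pow_two]
      rw [hk, ← consWord_head_tail x] at hx
      obtain h | h : x 0 = 0 ∨ x 0 = 1 := by omega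
      · rw [h, zpow_consWord rot_sq_zero, inv_zpow'] at hx
        have := ih (-k) _ (by omega) (consWord_inj hx).2
        omega
      · rw [h, zpow_consWord rot_sq_one] at hx
        have := ih k _ (by omega) (consWord_inj hx).2
        omega
    · have hk : rot ^ (2 * k + 1) = rot * (rot * rot) ^ k := by
        rw [add_comm, zpow_add, zpow_one, zpow_mul, zpow_ofNat, pow_two]
      rw [hk] at hx
      have hx2 : rot (((rot * rot) ^ k) x) = x := hx
      have h3 : (((rot * rot) ^ k) x) 0 = x 0 := by
        obtain h | h : x 0 = 0 ∨ x 0 = 1 := by omega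
        · rw [← consWord_head_tail x, h, zpow_consWord rot_sq_zero]; rfl
        · rw [← consWord_head_tail x, h, zpow_consWord rot_sq_one]; rfl
      have := rot_apply_zero (((rot * rot) ^ k) x)
      rw [hx2, h3] at this
      exact this rfl

theorem actA_no_fix (x : InfWord) : act (.of .a) x ≠ x := by
  intro hx
  rw [← consWord_head_tail x] at hx
  obtain h | h : x 0 = 0 ∨ x 0 = 1 := by omega
  · rw [h, act_a_zero] at hx
    have := (consWord_inj hx).1
    omega
  · rw [h, act_a_one] at hx
    have := (consWord_inj hx).1
    omega

theorem actB_fix_aux {x : InfWord} (hx : act (.of .b) x = x) :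
    x 0 = 1 ∧ act (.of .b) (dropWord 1 x) = dropWord 1 x := by
  rw [← consWord_head_tail x] at hx
  obtain h | h : x 0 = 0 ∨ x 0 = 1 := by omega
  · rw [h, act_b_zero] at hx
    exact absurd (consWord_inj hx).2 (actA_no_fix _)
  · rw [h, act_b_one] at hx
    exact ⟨h, (consWord_inj hx).2⟩

theorem actB_fix {x : InfWord} (hx : act (.of .b) x = x) (n : ℕ) : x n = 1 := by
  induction n generalizing x with
  | zero => exact (actB_fix_aux hx).1
  | succ n ih =>
    rw [Nat.add_comm]
    exact ih (actB_fix_aux hx).2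

theorem exists_ne_one {U : Set InfWord} (hU : IsOpen U) (hne : U.Nonempty) :
    ∃ x ∈ U, ∃ n, x n ≠ 1 := by
  by_contra hcon
  push Not at hcon
  obtain ⟨x, hx⟩ := hne
  have ht : Filter.Tendsto (fun n => Function.update x n 0) Filter.atTop (𝓝 x) := by
    rw [tendsto_pi_nhds]
    intro i
    refine tendsto_const_nhds.congr' ?_
    filter_upwards [Filter.eventually_gt_atTop i] with n hn
    rw [Function.update_of_ne (by omega)]
  obtain ⟨n, hn⟩ := (ht.eventually (hU.mem_nhds hx)).exists
  have := hcon _ hn n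
  simp at this

/-- An element of `Γ` that fixes a nonempty open set pointwise acts trivially. -/
theorem act_eq_one_of_fix (g : Dinf) {U : Set InfWord} (hU : IsOpen U) (hne : U.Nonempty)
    (hfix : ∀ x ∈ U, act g x = x) : act g = 1 := by
  obtain ⟨n, hn | hn⟩ := act_eq g
  · obtain ⟨x, hx⟩ := hne
    have := hfix x hx
    rw [hn] at this
    have h0 := rot_zpow_free _ n x le_rfl this
    rw [hn, h0, zpow_zero]
  · exfalso
    obtain ⟨k, hk⟩ := Int.even_or_odd' n
    have hconj : ∃ r : InfWord ≃ₜ InfWord, (r = act (.of .a) ∨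
        r = act (.of .a) * act (.of .b) * act (.of .a)) ∧
        act g = rot ^ k * r * rot ^ (-k) := by
      rcases hk with hk | hk
      · refine ⟨_, Or.inl rfl, ?_⟩
        rw [hn, hk, mul_assoc, actA_conj, neg_neg, ← mul_assoc, ← zpow_add, two_mul]
      · refine ⟨_, Or.inr rfl, ?_⟩
        rw [hn, hk, mul_assoc (rot ^ k), mul_assoc _ (act (.of .a)) (rot ^ (-k)), actA_conj,
          neg_neg, ← rot, ← mul_assoc rot, ← mul_assoc (rot ^ k), ← zpow_one_add, ← zpow_add]
        congr 2; ring
    obtain ⟨r, hr, hgr⟩ := hconj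
    have hV : ∀ x ∈ (rot ^ k) ⁻¹' U, r x = x := by
      intro x hx
      have h1 := hfix _ hx
      rw [hgr] at h1
      have h2 : (rot ^ k) (r ((rot ^ (-k) * rot ^ k) x)) = (rot ^ k) x := h1
      rw [← zpow_add, neg_add_cancel, zpow_zero] at h2
      exact (rot ^ k).injective h2
    have hVo : IsOpen ((rot ^ k) ⁻¹' U) := hU.preimage (rot ^ k).continuous
    have hVne : ((rot ^ k) ⁻¹' U).Nonempty := by
      obtain ⟨x, hx⟩ := hne
      exact ⟨(rot ^ k).symm x, by simpa using hx⟩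
    rcases hr with rfl | rfl
    · obtain ⟨x, hx⟩ := hVne
      exact actA_no_fix x (hV x hx)
    · obtain ⟨y, hy, m, hm⟩ := exists_ne_one
        (U := (act (.of .a)) ⁻¹' ((rot ^ k) ⁻¹' U))
        (hVo.preimage (act (.of .a)).continuous) (by
          obtain ⟨x, hx⟩ := hVne
          exact ⟨(act (.of .a)).symm x, by simpa using hx⟩)
      have h1 : act (.of .a) (act (.of .b) ((act (.of .a) * act (.of .a)) y)) =
          act (.of .a) y := hV _ hy
      rw [actA_sq] at h1
      exact hm (actB_fix ((act (.of .a)).injective h1) m)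


/-! ## The local homeomorphisms `S_(α,g,β)` -/

/-- Triples `(α, g, β)` with `α, β ∈ X^*` and `g ∈ Γ`. -/
structure Triple : Type where
  left : List (Fin 2)
  elt : Dinf
  right : List (Fin 2)

/-- The triple `(β, g⁻¹, α)`. -/
def Triple.symm (t : Triple) : Triple := ⟨t.right, t.elt⁻¹, t.left⟩

/-- The homeomorphism `S_(α,g,β) : Z(β) → Z(α)`, `β x ↦ α (g·x)`. -/
def localHomeo (t : Triple) : OpenPartialHomeomorph InfWord InfWord where
  toFun x := prepend t.left (act t.elt (dropWord t.right.length x))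
  invFun x := prepend t.right (act t.elt⁻¹ (dropWord t.left.length x))
  source := cyl t.right
  target := cyl t.left
  map_source' _ _ := ⟨_, rfl⟩
  map_target' _ _ := ⟨_, rfl⟩
  left_inv' := by
    rintro _ ⟨x, rfl⟩
    rw [dropWord_prepend, dropWord_prepend, act_inv_apply]
  right_inv' := by
    rintro _ ⟨x, rfl⟩
    rw [dropWord_prepend, dropWord_prepend, act_apply_inv]
  open_source := isOpen_cyl _
  open_target := isOpen_cyl _
  continuousOn_toFun := ((continuous_prepend _).comp
    ((act t.elt).continuous.comp (continuous_dropWord _))).continuousOn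
  continuousOn_invFun := ((continuous_prepend _).comp
    ((act t.elt⁻¹).continuous.comp (continuous_dropWord _))).continuousOn

theorem localHomeo_apply (t : Triple) (x : InfWord) :
    localHomeo t (prepend t.right x) = prepend t.left (act t.elt x) := by
  change prepend t.left (act t.elt (dropWord t.right.length (prepend t.right x))) = _
  rw [dropWord_prepend]

theorem localHomeo_mem (t : Triple) (x : InfWord) : localHomeo t x ∈ cyl t.left := ⟨_, rfl⟩

theorem localHomeo_mem_symm (t : Triple) (x : InfWord) : localHomeo t x ∈ cyl t.symm.right :=
  ⟨_, rfl⟩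

theorem continuous_localHomeo (t : Triple) : Continuous (localHomeo t) :=
  (continuous_prepend _).comp ((act t.elt).continuous.comp (continuous_dropWord _))

theorem localHomeo_symm_apply (t : Triple) {x : InfWord} (hx : x ∈ cyl t.right) :
    localHomeo t.symm (localHomeo t x) = x := (localHomeo t).left_inv hx

theorem localHomeo_apply_symm (t : Triple) {x : InfWord} (hx : x ∈ cyl t.left) :
    localHomeo t (localHomeo t.symm x) = x := (localHomeo t).right_inv hx

theorem cyl_append_subset (β δ : List (Fin 2)) : cyl (β ++ δ) ⊆ cyl β := by
  rintro _ ⟨x, rfl⟩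
  exact ⟨prepend δ x, (prepend_append β δ x).symm⟩

theorem cyl_mem_nhds {α : List (Fin 2)} {x : InfWord} (hx : x ∈ cyl α) : cyl α ∈ 𝓝 x :=
  (isOpen_cyl α).mem_nhds hx

/-- Restriction of `S_(α,g,β)` to a smaller cylinder `Z(βδ)`. -/
theorem localHomeo_restrict (t : Triple) (δ : List (Fin 2)) :
    ∃ (p : List (Fin 2)) (h : Dinf), p.length = t.left.length + δ.length ∧ cyl p ⊆ cyl t.left ∧
      ∀ z, localHomeo t (prepend (t.right ++ δ) z) = prepend p (act h z) := by
  obtain ⟨δ', h, hl, H⟩ := act_prepend t.elt δ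
  refine ⟨t.left ++ δ', h, by simp [hl], cyl_append_subset _ _, fun z => ?_⟩
  rw [prepend_append, localHomeo_apply, H, prepend_append]

/-- Every point of `Z(β)` lies in a cylinder `Z(βδ)` with `δ` of given length. -/
theorem exists_longer {β : List (Fin 2)} {x : InfWord} (hx : x ∈ cyl β) (k : ℕ) :
    ∃ (δ : List (Fin 2)) (z : InfWord), δ.length = k ∧ x = prepend (β ++ δ) z := by
  obtain ⟨y, rfl⟩ := hx
  obtain ⟨δ, hδ, h⟩ := prepend_take k y
  exact ⟨δ, dropWord k y, hδ, by rw [prepend_append, h]⟩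

theorem exists_comp (s t : Triple) {x : InfWord} (hx : x ∈ cyl t.right)
    (hx' : localHomeo t x ∈ cyl s.right) :
    ∃ r : Triple, x ∈ cyl r.right ∧ localHomeo r =ᶠ[𝓝 x] localHomeo s ∘ localHomeo t ∧
      (r.left.length : ℤ) - r.right.length =
        (s.left.length - s.right.length) + (t.left.length - t.right.length) := by
  obtain ⟨δ, z, hδ, rfl⟩ := exists_longer hx s.right.length
  obtain ⟨p, h, hp, -, H⟩ := localHomeo_restrict t δ
  obtain ⟨ε, w, hε, hw⟩ := exists_longer hx' t.left.length
  rw [H] at hw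
  obtain ⟨hpe, hzw⟩ := prepend_eq_prepend (by simp [hp, hδ, hε, Nat.add_comm]) hw
  obtain ⟨q, k, hq, -, K⟩ := localHomeo_restrict s ε
  refine ⟨⟨q, k * h, t.right ++ δ⟩, ⟨z, rfl⟩, ?_, ?_⟩
  · filter_upwards [cyl_mem_nhds (α := t.right ++ δ) ⟨z, rfl⟩]
    rintro _ ⟨y, rfl⟩
    rw [Function.comp, H, hpe, K, ← act_mul_apply]
    exact localHomeo_apply ⟨q, k * h, t.right ++ δ⟩ y
  · simp only [List.length_append]
    omega

theorem prepend_apply_of_lt {γ : List (Fin 2)} {i : ℕ} (hi : i < γ.length) (x y : InfWord) :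
    prepend γ x i = prepend γ y i := by
  induction γ generalizing i with
  | nil => simp at hi
  | cons c γ ih =>
    cases i with
    | zero => rfl
    | succ i => exact ih (by simpa using hi)

theorem exists_cyl {V : Set InfWord} (hV : IsOpen V) {x : InfWord} (hx : x ∈ V) :
    ∃ γ : List (Fin 2), ∀ z, prepend γ z ∈ V := by
  obtain ⟨I, u, hu, hsub⟩ := isOpen_pi_iff.1 hV x hx
  obtain ⟨γ, hγ, h⟩ := prepend_take (I.sup id + 1) x
  refine ⟨γ, fun z => hsub fun i hi => ?_⟩
  have hlt : i < γ.length := by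
    rw [hγ]
    exact Nat.lt_succ_of_le (Finset.le_sup (f := id) hi)
  rw [prepend_apply_of_lt hlt z (dropWord (I.sup id + 1) x), h]
  exact (hu i hi).2

theorem length_le_of_eq {p q : List (Fin 2)} {h k : Dinf}
    (H : ∀ z, prepend p (act h z) = prepend q (act k z)) : q.length ≤ p.length := by
  by_contra hlt
  push Not at hlt
  have hq : q.take p.length ++ q.drop p.length = q := List.take_append_drop _ _
  have hr : ∀ z, act h z = prepend (q.drop p.length) (act k z) := fun z => by
    have := H z
    rw [← hq, prepend_append] at this
    exact (prepend_eq_prepend (by simp; omega) this).2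
  obtain ⟨c, r, hcr⟩ : ∃ c r, q.drop p.length = c :: r := by
    cases hd : q.drop p.length with
    | nil => rw [List.drop_eq_nil_iff] at hd; omega
    | cons c r => exact ⟨c, r, rfl⟩
  have h1 := congrFun (hr (act h⁻¹ (consWord (c + 1) 0))) 0
  rw [act_apply_inv, hcr] at h1
  have h2 : c + 1 = c := h1
  revert h2
  fin_cases c <;> simp

theorem rigid {p q : List (Fin 2)} {h k : Dinf} {V : Set InfWord} (hV : IsOpen V)
    (hne : V.Nonempty) (H : ∀ z ∈ V, prepend p (act h z) = prepend q (act k z)) :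
    p = q ∧ act h = act k := by
  obtain ⟨x, hx⟩ := hne
  obtain ⟨γ, hγ⟩ := exists_cyl hV hx
  obtain ⟨γ₁, h', hl₁, H₁⟩ := act_prepend h γ
  obtain ⟨γ₂, k', hl₂, H₂⟩ := act_prepend k γ
  have key : ∀ z, prepend (p ++ γ₁) (act h' z) = prepend (q ++ γ₂) (act k' z) := fun z => by
    rw [prepend_append, prepend_append, ← H₁, ← H₂]
    exact H _ (hγ z)
  have hlen : p.length = q.length := by
    have h1 := length_le_of_eq key
    have h2 := length_le_of_eq fun z => (key z).symm
    simp only [List.length_append] at h1 h2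
    omega
  have hpq := fun z hz => prepend_eq_prepend hlen (H z hz)
  refine ⟨(hpq x hx).1, ?_⟩
  have hone : act (k⁻¹ * h) = 1 := by
    refine act_eq_one_of_fix _ hV ⟨x, hx⟩ fun z hz => ?_
    rw [act_mul_apply, (hpq z hz).2, act_inv_apply]
  rw [map_mul, map_inv, inv_mul_eq_one] at hone
  exact hone.symm

/-- Two of the local homeomorphisms, near a common point `x` of their domains: if they agree near
some point of a suitable neighbourhood of `x`, then they agree near `x`. -/
theorem exists_rigid_nhd (s t : Triple) {x : InfWord} (hs : x ∈ cyl s.right)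
    (ht : x ∈ cyl t.right) :
    ∃ η : List (Fin 2), x ∈ cyl η ∧ cyl η ⊆ cyl s.right ∧ cyl η ⊆ cyl t.right ∧
      ∀ y ∈ cyl η, localHomeo s =ᶠ[𝓝 y] localHomeo t →
        localHomeo s =ᶠ[𝓝 x] localHomeo t ∧
        (s.left.length : ℤ) - s.right.length = t.left.length - t.right.length := by
  obtain ⟨δ, z, hδ, hz⟩ := exists_longer hs t.right.length
  obtain ⟨ε, w, hε, hw⟩ := exists_longer ht s.right.length
  have hη : s.right ++ δ = t.right ++ ε :=
    (prepend_eq_prepend (by simp [hδ, hε, Nat.add_comm]) (hz.symm.trans hw)).1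
  have hxη : x ∈ cyl (s.right ++ δ) := ⟨z, hz.symm⟩
  refine ⟨s.right ++ δ, hxη, cyl_append_subset _ _, hη ▸ cyl_append_subset _ _, ?_⟩
  rintro _ ⟨y, rfl⟩ hy
  obtain ⟨p, h, hp, -, H⟩ := localHomeo_restrict s δ
  obtain ⟨q, k, hq, -, K⟩ := localHomeo_restrict t ε
  rw [← hη] at K
  obtain ⟨O, hO, hOo, hyO⟩ := eventually_nhds_iff.1 hy
  obtain ⟨hpq, hhk⟩ := rigid (hOo.preimage (continuous_prepend (s.right ++ δ))) ⟨y, hyO⟩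
    (p := p) (q := q) (h := h) (k := k) fun v hv => by rw [← H, ← K]; exact hO _ hv
  constructor
  · filter_upwards [cyl_mem_nhds hxη]
    rintro _ ⟨v, rfl⟩
    rw [H, K, hpq, hhk]
  · rw [hpq] at hp
    omega

/-! ## The groupoid of germs -/

/-- A pair of a triple `(α, g, β)` and a point `x ∈ Z(β)`. -/
structure GermRep : Type where
  triple : Triple
  pt : InfWord
  mem : pt ∈ cyl triple.right

/-- `(S, x)` and `(S', x')` have the same germ if `x = x'` and `S`, `S'` coincide in a neighbourhood
of `x`. -/
instance germSetoid : Setoid GermRep where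
  r p q := p.pt = q.pt ∧ localHomeo p.triple =ᶠ[𝓝 p.pt] localHomeo q.triple
  iseqv :=
    { refl := fun _ => ⟨rfl, Filter.EventuallyEq.refl _ _⟩
      symm := fun h => ⟨h.1.symm, by rw [← h.1]; exact h.2.symm⟩
      trans := fun h h' => ⟨h.1.trans h'.1, h.2.trans (by rw [h.1]; exact h'.2)⟩ }

/-- The set of arrows of the groupoid of germs `𝒢_(Γ,X)`. -/
def Arrow : Type := Quotient germSetoid

/-- The germ `[α, g, β; x]`. -/
def germ (t : Triple) (x : InfWord) (hx : x ∈ cyl t.right) : Arrow := ⟦⟨t, x, hx⟩⟧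

theorem germ_eq_iff {s t : Triple} {x y : InfWord} {hx : x ∈ cyl s.right}
    {hy : y ∈ cyl t.right} :
    germ s x hx = germ t y hy ↔ x = y ∧ localHomeo s =ᶠ[𝓝 x] localHomeo t :=
  Quotient.eq (r := germSetoid)

theorem exists_germ (γ : Arrow) : ∃ t x hx, γ = germ t x hx := by
  induction γ using Quotient.inductionOn with
  | h r => exact ⟨r.triple, r.pt, r.mem, rfl⟩

/-- The basic open set `Z(α, g, β; U) = {[α, g, β; x] : x ∈ U}`, for `U ⊆ Z(β)`. -/
def basicOpen (t : Triple) (U : Set InfWord) : Set Arrow :=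
  {γ | ∃ (x : InfWord) (hx : x ∈ cyl t.right), x ∈ U ∧ γ = germ t x hx}

/-- The topology on the groupoid of germs, generated by the sets `Z(α, g, β; U)` with `U` an open
subset of `Z(β)`. -/
instance : TopologicalSpace Arrow :=
  TopologicalSpace.generateFrom
    {O | ∃ (t : Triple) (U : Set InfWord), IsOpen U ∧ U ⊆ cyl t.right ∧ O = basicOpen t U}

/-- The source of `[S, x]` is `x`. -/
def src (γ : Arrow) : InfWord := Quotient.lift GermRep.pt (by rintro p q ⟨hpt, -⟩; exact hpt) γ

/-- The range of `[S, x]` is `S(x)`. -/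
def rng (γ : Arrow) : InfWord :=
  Quotient.lift (fun p : GermRep => localHomeo p.triple p.pt)
    (by rintro p q ⟨hpt, h⟩; exact h.eq_of_nhds.trans (by rw [hpt])) γ

/-- The unit at `x`, that is, the germ at `x` of the identity. -/
def unit (x : InfWord) : Arrow := germ ⟨[], 1, []⟩ x ⟨x, rfl⟩

theorem symm_germ {s t : Triple} {x : InfWord} (hs : x ∈ cyl s.right) (ht : x ∈ cyl t.right)
    (h : localHomeo s =ᶠ[𝓝 x] localHomeo t) :
    localHomeo s.symm =ᶠ[𝓝 (localHomeo s x)] localHomeo t.symm := by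
  have hc : Filter.Tendsto (localHomeo s.symm) (𝓝 (localHomeo s x)) (𝓝 x) := by
    have := (continuous_localHomeo s.symm).tendsto (localHomeo s x)
    rwa [localHomeo_symm_apply s hs] at this
  filter_upwards [hc.eventually h, hc.eventually (cyl_mem_nhds ht),
    cyl_mem_nhds (localHomeo_mem s x)] with y h1 h2 h3
  rw [localHomeo_apply_symm s h3] at h1
  have h4 := localHomeo_symm_apply t h2
  rw [← h1] at h4
  exact h4.symm

/-- The inverse `[α, g, β; x]⁻¹ = [β, g⁻¹, α; S_(α,g,β)(x)]`. -/
def inv (γ : Arrow) : Arrow :=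
  Quotient.map (fun p : GermRep => (⟨p.triple.symm, localHomeo p.triple p.pt,
      localHomeo_mem_symm _ _⟩ : GermRep))
    (by
      rintro p q ⟨hpt, h⟩
      exact ⟨h.eq_of_nhds.trans (by rw [hpt]), symm_germ p.mem (hpt ▸ q.mem) h⟩) γ

/-- `κ` is the product of `γ` and `η`: one has `γ = [S, T(x)]`, `η = [T, x]` and `κ = [S T, x]`. -/
def IsProd (γ η κ : Arrow) : Prop :=
  ∃ (s t r : Triple) (x : InfWord) (ht : x ∈ cyl t.right) (hs : localHomeo t x ∈ cyl s.right)
    (hr : x ∈ cyl r.right), γ = germ s (localHomeo t x) hs ∧ η = germ t x ht ∧ κ = germ r x hr ∧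
      localHomeo r =ᶠ[𝓝 x] localHomeo s ∘ localHomeo t

open Classical in
/-- The product of composable arrows (an irrelevant value if they are not composable). -/
noncomputable def mul (γ η : Arrow) : Arrow :=
  if h : ∃ κ, IsProd γ η κ then h.choose else γ

theorem IsProd.unique {γ η κ κ' : Arrow} (h : IsProd γ η κ) (h' : IsProd γ η κ') : κ = κ' := by
  obtain ⟨s, t, r, x, ht, hs, hr, rfl, rfl, rfl, H⟩ := h
  obtain ⟨s', t', r', x', ht', hs', hr', h1, h2, rfl, H'⟩ := h'
  obtain ⟨rfl, k2⟩ := germ_eq_iff.1 h2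
  obtain ⟨-, k1⟩ := germ_eq_iff.1 h1
  refine germ_eq_iff.2 ⟨rfl, H.trans (Filter.EventuallyEq.trans ?_ H'.symm)⟩
  filter_upwards [k2, (continuous_localHomeo t).tendsto x |>.eventually k1] with y h3 h4
  rw [Function.comp, Function.comp, h4, h3]

theorem mul_eq {γ η κ : Arrow} (h : IsProd γ η κ) : mul γ η = κ := by
  have h' : ∃ κ, IsProd γ η κ := ⟨κ, h⟩
  rw [mul, dif_pos h']
  exact h'.choose_spec.unique h

/-- The cocycle `c([α, g, β; x]) = |α| - |β|`. -/
def cocycle (γ : Arrow) : ℤ :=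
  Quotient.lift (fun p : GermRep => (p.triple.left.length : ℤ) - p.triple.right.length)
    (by
      rintro p q ⟨hpt, h⟩
      obtain ⟨η, hη, -, -, H⟩ := exists_rigid_nhd p.triple q.triple p.mem (hpt ▸ q.mem)
      exact (H _ hη h).2) γ

theorem cocycle_germ {t : Triple} {x : InfWord} (hx : x ∈ cyl t.right) :
    cocycle (germ t x hx) = (t.left.length : ℤ) - t.right.length := rfl

theorem exists_prod {γ η : Arrow} (h : src γ = rng η) :
    ∃ κ, IsProd γ η κ ∧ cocycle κ = cocycle γ + cocycle η := by
  obtain ⟨s, x', hs, rfl⟩ := exists_germ γ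
  obtain ⟨t, x, ht, rfl⟩ := exists_germ η
  obtain rfl : x' = localHomeo t x := h
  obtain ⟨r, hr, H, hc⟩ := exists_comp s t ht hs
  exact ⟨germ r x hr, ⟨s, t, r, x, ht, hs, hr, rfl, rfl, rfl, H⟩, hc⟩

theorem cocycle_mul (γ η : Arrow) (h : src γ = rng η) :
    cocycle (mul γ η) = cocycle γ + cocycle η := by
  obtain ⟨κ, hκ, hc⟩ := exists_prod h
  rw [mul_eq hκ, hc]

theorem isOpen_basicOpen (t : Triple) {U : Set InfWord} (hU : IsOpen U) :
    IsOpen (basicOpen t U) := by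
  have : basicOpen t U = basicOpen t (U ∩ cyl t.right) := by
    ext γ
    constructor
    · rintro ⟨x, hx, hxU, rfl⟩
      exact ⟨x, hx, ⟨hxU, hx⟩, rfl⟩
    · rintro ⟨x, hx, hxU, rfl⟩
      exact ⟨x, hx, hxU.1, rfl⟩
  rw [this]
  exact TopologicalSpace.isOpen_generateFrom_of_mem
    ⟨t, _, hU.inter (isOpen_cyl _), Set.inter_subset_right, rfl⟩

open Classical in
/-- The local section `x ↦ [α, g, β; x]` of the source map. -/
noncomputable def sec (t : Triple) (x : InfWord) : Arrow :=
  if hx : x ∈ cyl t.right then germ t x hx else unit x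

theorem sec_eq {t : Triple} {x : InfWord} (hx : x ∈ cyl t.right) : sec t x = germ t x hx :=
  dif_pos hx

theorem continuousOn_sec (t : Triple) : ContinuousOn (sec t) (cyl t.right) := by
  rw [continuousOn_iff_continuous_domRestrict, continuous_generateFrom_iff]
  rintro _ ⟨s, U, hU, hUs, rfl⟩
  have : (cyl t.right).domRestrict (sec t) ⁻¹' basicOpen s U =
      Subtype.val ⁻¹' (U ∩ {x | ∀ᶠ y in 𝓝 x, localHomeo t y = localHomeo s y}) := by
    ext ⟨x, hx⟩
    simp only [Set.mem_preimage, Set.domRestrict_apply, sec_eq hx]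
    constructor
    · rintro ⟨y, hy, hyU, h⟩
      obtain ⟨rfl, h'⟩ := germ_eq_iff.1 h
      exact ⟨hyU, h'⟩
    · rintro ⟨h1, h2⟩
      exact ⟨x, hUs h1, h1, germ_eq_iff.2 ⟨rfl, h2⟩⟩
  rw [this]
  exact (hU.inter isOpen_setOfPred_eventually_nhds).preimage continuous_subtype_val

theorem continuousAt_sec (t : Triple) {x : InfWord} (hx : x ∈ cyl t.right) :
    ContinuousAt (sec t) x := (continuousOn_sec t).continuousAt (cyl_mem_nhds hx)

theorem continuous_src : Continuous src := by
  rw [continuous_def]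
  intro U hU
  have : src ⁻¹' U = ⋃ t : Triple, basicOpen t U := by
    ext γ
    rw [Set.mem_iUnion]
    constructor
    · intro h
      obtain ⟨t, x, hx, rfl⟩ := exists_germ γ
      exact ⟨t, x, hx, h, rfl⟩
    · rintro ⟨t, x, hx, hxU, rfl⟩
      exact hxU
  rw [this]
  exact isOpen_iUnion fun t => isOpen_basicOpen t hU

theorem basicOpen_mem_nhds {t : Triple} {x : InfWord} (hx : x ∈ cyl t.right) {U : Set InfWord}
    (hU : U ∈ 𝓝 x) : basicOpen t U ∈ 𝓝 (germ t x hx) := by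
  obtain ⟨V, hVU, hV, hxV⟩ := mem_nhds_iff.1 hU
  refine Filter.mem_of_superset ((isOpen_basicOpen t hV).mem_nhds ⟨x, hx, hxV, rfl⟩) ?_
  rintro _ ⟨y, hy, hyV, rfl⟩
  exact ⟨y, hy, hVU hyV, rfl⟩

theorem isLocalHomeomorph_src : IsLocalHomeomorph src := by
  intro γ
  obtain ⟨t, x, hx, rfl⟩ := exists_germ γ
  exact ⟨{
    toFun := src
    invFun := sec t
    source := basicOpen t Set.univ
    target := cyl t.right
    map_source' := by rintro _ ⟨y, hy, -, rfl⟩; exact hy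
    map_target' := fun y hy => ⟨y, hy, trivial, sec_eq hy⟩
    left_inv' := by rintro _ ⟨y, hy, -, rfl⟩; exact sec_eq hy
    right_inv' := fun y hy => by rw [sec_eq hy]; rfl
    open_source := isOpen_basicOpen t isOpen_univ
    open_target := isOpen_cyl _
    continuousOn_toFun := continuous_src.continuousOn
    continuousOn_invFun := continuousOn_sec t }, ⟨x, hx, trivial, rfl⟩, rfl⟩

theorem src_inv (γ : Arrow) : src (inv γ) = rng γ := by
  obtain ⟨t, x, hx, rfl⟩ := exists_germ γ
  rfl

theorem rng_inv (γ : Arrow) : rng (inv γ) = src γ := by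
  obtain ⟨t, x, hx, rfl⟩ := exists_germ γ
  exact localHomeo_symm_apply t hx

theorem inv_germ {t : Triple} {x : InfWord} (hx : x ∈ cyl t.right) :
    inv (germ t x hx) = germ t.symm (localHomeo t x) (localHomeo_mem_symm _ _) := rfl

theorem inv_inv (γ : Arrow) : inv (inv γ) = γ := by
  obtain ⟨t, x, hx, rfl⟩ := exists_germ γ
  rw [inv_germ, inv_germ, germ_eq_iff]
  refine ⟨localHomeo_symm_apply t hx, Filter.Eventually.of_forall fun y => ?_⟩
  change prepend _ (act t.elt⁻¹⁻¹ _) = prepend _ (act t.elt _)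
  rw [_root_.inv_inv]
  rfl

theorem continuous_inv : Continuous inv := by
  rw [continuous_iff_continuousAt]
  intro γ
  obtain ⟨t, x, hx, rfl⟩ := exists_germ γ
  have h : ContinuousAt (fun γ => sec t.symm (localHomeo t (src γ))) (germ t x hx) :=
    ContinuousAt.comp (g := sec t.symm) (continuousAt_sec t.symm (localHomeo_mem_symm t x))
      ((continuous_localHomeo t).comp continuous_src).continuousAt
  refine h.congr ?_
  filter_upwards [basicOpen_mem_nhds hx Filter.univ_mem]
  rintro _ ⟨y, hy, -, rfl⟩
  exact sec_eq (localHomeo_mem_symm t y)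

theorem isLocalHomeomorph_rng : IsLocalHomeomorph rng := by
  let Φ : Arrow ≃ₜ Arrow := ⟨⟨inv, inv, inv_inv, inv_inv⟩, continuous_inv, continuous_inv⟩
  have h := isLocalHomeomorph_src.comp Φ.isLocalHomeomorph
  convert h using 1
  funext γ
  exact (src_inv γ).symm

theorem localHomeo_one (x : InfWord) : localHomeo ⟨[], 1, []⟩ x = x := by
  have h := localHomeo_apply ⟨[], 1, []⟩ x
  rw [map_one] at h
  exact h

theorem continuousOn_mul :
    ContinuousOn (fun p : Arrow × Arrow => mul p.1 p.2) {p | src p.1 = rng p.2} := by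
  rintro ⟨γ, η⟩ hp
  obtain ⟨κ, ⟨s, t, r, x, ht, hs, hr, rfl, rfl, rfl, H⟩, -⟩ := exists_prod hp
  have hc : ContinuousAt (fun p : Arrow × Arrow => sec r (src p.2))
      (germ s (localHomeo t x) hs, germ t x ht) :=
    ContinuousAt.comp (g := sec r) (continuousAt_sec r hr)
      (continuous_src.comp continuous_snd).continuousAt
  have hval : mul (germ s (localHomeo t x) hs) (germ t x ht) = germ r x hr :=
    mul_eq ⟨s, t, r, x, ht, hs, hr, rfl, rfl, rfl, H⟩
  refine hc.continuousWithinAt.congr_of_eventuallyEq ?_ (hval.trans (sec_eq hr).symm)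
  rw [Filter.EventuallyEq, eventually_nhdsWithin_iff]
  have hU : {y | y ∈ cyl r.right ∧ localHomeo r =ᶠ[𝓝 y] localHomeo s ∘ localHomeo t} ∈ 𝓝 x :=
    Filter.inter_mem (cyl_mem_nhds hr) (eventually_eventually_nhds.2 H)
  filter_upwards [prod_mem_nhds (basicOpen_mem_nhds hs Filter.univ_mem)
    (basicOpen_mem_nhds ht hU)]
  rintro ⟨_, _⟩ ⟨⟨y', hy', -, rfl⟩, ⟨y, hy, ⟨hyr, hyH⟩, rfl⟩⟩ hcomp
  obtain rfl : y' = localHomeo t y := hcomp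
  exact (mul_eq ⟨s, t, r, y, hy, hy', hyr, rfl, rfl, rfl, hyH⟩).trans (sec_eq hyr).symm

/-- The groupoid of germs `𝒢_(Γ,X)` of the self-similar infinite dihedral group. -/
noncomputable def germGroupoid : EtaleGroupoid InfWord Arrow where
  src := src
  rng := rng
  unit := unit
  inv := inv
  mul := mul
  src_unit _ := rfl
  rng_unit := localHomeo_one
  src_inv := src_inv
  rng_inv := rng_inv
  src_mul γ η h := by
    obtain ⟨κ, hκ, -⟩ := exists_prod h
    rw [mul_eq hκ]
    obtain ⟨s, t, r, x, ht, hs, hr, rfl, rfl, rfl, H⟩ := hκ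
    rfl
  rng_mul γ η h := by
    obtain ⟨κ, hκ, -⟩ := exists_prod h
    rw [mul_eq hκ]
    obtain ⟨s, t, r, x, ht, hs, hr, rfl, rfl, rfl, H⟩ := hκ
    exact H.eq_of_nhds
  mul_assoc γ η κ h h' := by
    obtain ⟨s, x₁, hs, rfl⟩ := exists_germ γ
    obtain ⟨t, x₂, ht, rfl⟩ := exists_germ η
    obtain ⟨r, x, hr, rfl⟩ := exists_germ κ
    obtain rfl : x₂ = localHomeo r x := h'
    obtain rfl : x₁ = localHomeo t (localHomeo r x) := h
    obtain ⟨u, hu, U, -⟩ := exists_comp s t ht hs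
    obtain ⟨v, hv, V, -⟩ := exists_comp t r hr ht
    obtain ⟨w, hw, W, -⟩ := exists_comp u r hr hu
    have e1 : mul (germ s _ hs) (germ t _ ht) = germ u _ hu :=
      mul_eq ⟨s, t, u, _, ht, hs, hu, rfl, rfl, rfl, U⟩
    have e2 : mul (germ t _ ht) (germ r _ hr) = germ v _ hv :=
      mul_eq ⟨t, r, v, _, hr, ht, hv, rfl, rfl, rfl, V⟩
    have e3 : mul (germ u _ hu) (germ r _ hr) = germ w _ hw :=
      mul_eq ⟨u, r, w, _, hr, hu, hw, rfl, rfl, rfl, W⟩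
    have hvx : localHomeo v x = localHomeo t (localHomeo r x) := V.eq_of_nhds
    have e4 : mul (germ s _ hs) (germ v _ hv) = germ w _ hw := by
      refine mul_eq ⟨s, v, w, x, hv, hvx ▸ hs, hw, ?_, rfl, rfl, ?_⟩
      · exact germ_eq_iff.2 ⟨hvx.symm, Filter.EventuallyEq.refl _ _⟩
      · filter_upwards [W, V, (continuous_localHomeo r).tendsto x |>.eventually U]
          with y h1 h2 h3
        rw [h1, Function.comp, h3, Function.comp, Function.comp, h2, Function.comp]
    rw [e1, e3, e2, e4]
  unit_mul γ := by
    obtain ⟨t, x, ht, rfl⟩ := exists_germ γ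
    exact mul_eq ⟨⟨[], 1, []⟩, t, t, x, ht, ⟨_, rfl⟩, ht, rfl, rfl, rfl,
      Filter.Eventually.of_forall fun y => (localHomeo_one _).symm⟩
  mul_unit γ := by
    obtain ⟨t, x, ht, rfl⟩ := exists_germ γ
    refine mul_eq ⟨t, ⟨[], 1, []⟩, t, x, ⟨_, rfl⟩, (localHomeo_one x).symm ▸ ht, ht, ?_, rfl, rfl,
      Filter.Eventually.of_forall fun y => ?_⟩
    · exact germ_eq_iff.2 ⟨(localHomeo_one x).symm, Filter.EventuallyEq.refl _ _⟩
    · rw [Function.comp, localHomeo_one]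
  inv_mul γ := by
    obtain ⟨t, x, ht, rfl⟩ := exists_germ γ
    refine mul_eq ⟨t.symm, t, ⟨[], 1, []⟩, x, ht, localHomeo_mem_symm _ _, ⟨_, rfl⟩, rfl, rfl, rfl, ?_⟩
    filter_upwards [cyl_mem_nhds ht] with y hy
    rw [localHomeo_one, Function.comp, localHomeo_symm_apply t hy]
  mul_inv γ := by
    obtain ⟨t, x, ht, rfl⟩ := exists_germ γ
    have hx := localHomeo_symm_apply t ht
    refine mul_eq ⟨t, t.symm, ⟨[], 1, []⟩, localHomeo t x, localHomeo_mem_symm _ _, hx.symm ▸ ht,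
      ⟨_, rfl⟩, ?_, rfl, rfl, ?_⟩
    · exact germ_eq_iff.2 ⟨hx.symm, Filter.EventuallyEq.refl _ _⟩
    · filter_upwards [cyl_mem_nhds (localHomeo_mem t x)] with y hy
      rw [localHomeo_one, Function.comp, localHomeo_apply_symm t hy]
  continuous_unit := by
    have h := continuousOn_sec ⟨[], 1, []⟩
    rw [show cyl [] = Set.univ from Set.range_id, continuousOn_univ] at h
    convert h using 1
    funext x
    exact (sec_eq (t := ⟨[], 1, []⟩) ⟨x, rfl⟩).symm
  continuous_inv := continuous_inv
  continuousOn_mul := continuousOn_mul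
  isLocalHomeomorph_src := isLocalHomeomorph_src
  isLocalHomeomorph_rng := isLocalHomeomorph_rng

/-- The groupoid of germs is Hausdorff. -/
instance : T2Space Arrow := by
  refine ⟨fun γ η hne => ?_⟩
  obtain ⟨s, x, hs, rfl⟩ := exists_germ γ
  obtain ⟨t, y, ht, rfl⟩ := exists_germ η
  by_cases hxy : x = y
  · subst hxy
    obtain ⟨κ, hκ, -, -, H⟩ := exists_rigid_nhd s t hs ht
    refine ⟨basicOpen s (cyl κ), basicOpen t (cyl κ), isOpen_basicOpen s (isOpen_cyl κ),
      isOpen_basicOpen t (isOpen_cyl κ), ⟨x, hs, hκ, rfl⟩, ⟨x, ht, hκ, rfl⟩, ?_⟩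
    rw [Set.disjoint_left]
    rintro _ ⟨z, hz, hzκ, rfl⟩ ⟨z', hz', -, h⟩
    exact hne (germ_eq_iff.2 ⟨rfl, (H z hzκ (germ_eq_iff.1 h).2).1⟩)
  · obtain ⟨U, V, hU, hV, hx, hy, hd⟩ := t2_separation hxy
    exact ⟨src ⁻¹' U, src ⁻¹' V, hU.preimage continuous_src, hV.preimage continuous_src, hx, hy,
      hd.preimage src⟩

theorem continuous_cocycle : Continuous cocycle := by
  rw [continuous_iff_continuousAt]
  intro γ
  obtain ⟨t, x, hx, rfl⟩ := exists_germ γ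
  refine continuousAt_const.congr
    (f := fun _ => (t.left.length : ℤ) - t.right.length) ?_
  filter_upwards [basicOpen_mem_nhds hx Filter.univ_mem]
  rintro _ ⟨y, hy, -, rfl⟩
  rfl

/-- The groupoid `ℋ_(Γ,X) = c⁻¹(0) = {[α, g, β; x] : |α| = |β|}`. -/
noncomputable def kernelGroupoid : EtaleGroupoid InfWord {γ : Arrow // cocycle γ = 0} :=
  germGroupoid.cocycleKer cocycle cocycle_mul continuous_cocycle

end DihedralGroupoid

namespace DihedralGroupoid

/-! ## The group ring of the infinite dihedral group -/

open scoped MonoidAlgebra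

/-! The groupoid `ℋ` is the transformation groupoid of `Γ` acting on `X^∞`. Indeed, for words of
equal length every `S_(α,g,β)` is the restriction of the action of a single element of `Γ`
(`exists_act_prepend`), and the germ of an element of `Γ` at any point determines that element
(`arrow_injective`). Strings of length `n` therefore form a disjoint union of open copies of `X^∞`
indexed by `Γⁿ`, and the chain complex of `ℋ` becomes the inhomogeneous complex of `Γ` with
coefficients in `M = C(X^∞, ℤ)` (`chainIso`). So `H_*(ℋ) = H_*(Γ, M)`.

Since `Γ` is a free product of two groups of order two, `ℤ` has a free resolution `ℤ[Γ] ← ℤ[Γ]² ←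
ℤ[Γ]² ← ⋯` whose differentials on the summand of `s ∈ {a, b}` are right multiplication by `s - 1`,
and then alternately by `1 + s` and `1 - s`. Exactness in degree one is a modified Fox calculus
(`mul_one_sub_eq_zero`); in higher degrees it comes from splitting each coset `g{1, s}` into its two
elements (`exists_of_mul_eq_zero`). In degrees at least two the complex for `M` is thus a sum over
`s` of the periodic complexes of the groups `{1, s}` (`nsmul_groupHomology_eq_zero`).

In odd degrees a cycle satisfies `s x = x`, so `2 x = x + s x` is a boundary. In even degrees a
cycle `f` satisfies `s f = -f` and has to be written as `y - s y`. This is done by cutting `f` off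
to a clopen fundamental domain of `s`. For `a`, which exchanges `Z(0)` and `Z(1)`, the set `Z(0)`
serves. The generator `b` fixes the point `1^∞`; but `2 f(1^∞) = 0` forces `f` to vanish there,
hence near it, and away from `1^∞` there is a clopen fundamental domain
(`exists_sub_funRep_eq_of_add_eq_zero`). -/

noncomputable instance : DecidableEq Gen := Classical.decEq _

noncomputable instance : DecidableEq Dinf := Classical.decEq _

noncomputable instance : Fintype Gen := ⟨{.a, .b}, by rintro (_ | _) <;> simp⟩

theorem of_mul_of (i : Gen) : (PresentedGroup.of i : Dinf) * PresentedGroup.of i = 1 := by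
  rw [← pow_two]
  exact PresentedGroup.one_of_mem (rels := dihedralRels)
    (by cases i <;> simp [dihedralRels])

theorem of_inv (i : Gen) : (PresentedGroup.of i : Dinf)⁻¹ = PresentedGroup.of i :=
  inv_eq_of_mul_eq_one_right (of_mul_of i)

/-- A homomorphism on `Γ` is given by involutions, one for each generator. -/
def liftInvolutions {H : Type*} [Group H] (f : Gen → H) (hf : ∀ i, f i * f i = 1) : Dinf →* H :=
  PresentedGroup.toGroup (f := f) (rels := dihedralRels) (by
    rintro r (rfl | rfl) <;> simp [pow_two, hf])

theorem liftInvolutions_of {H : Type*} [Group H] (f : Gen → H) (hf : ∀ i, f i * f i = 1)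
    (i : Gen) : liftInvolutions f hf (PresentedGroup.of i) = f i :=
  PresentedGroup.toGroup.of _

/-- Induction on the word length of an element of `Γ`. -/
theorem dinf_induction {p : Dinf → Prop} (one : p 1)
    (mul : ∀ g i, p g → p (g * PresentedGroup.of i)) (g : Dinf) : p g := by
  have hg : g ∈ (⊤ : Subgroup Dinf) := trivial
  rw [← PresentedGroup.closure_range_of] at hg
  induction hg using Subgroup.closure_induction_right with
  | one => exact one
  | mul_right x y _ hy ih => obtain ⟨i, rfl⟩ := hy; exact mul _ _ ih
  | mul_inv_cancel x y _ hy ih => obtain ⟨i, rfl⟩ := hy; rw [of_inv]; exact mul _ _ ih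

/-- A generator as an element of the group ring. -/
noncomputable def ringGen (i : Gen) : ℤ[Dinf] := .single (.of i) 1

theorem ringGen_mul_self (i : Gen) : ringGen i * ringGen i = 1 := by
  rw [ringGen, MonoidAlgebra.single_mul_single, of_mul_of]; rfl

theorem coeff_mul_ringGen (i : Gen) (x : ℤ[Dinf]) (g : Dinf) :
    (x * ringGen i).coeff g = x.coeff (g * .of i) := by
  rw [ringGen, MonoidAlgebra.coeff_mul_single_apply, of_inv, mul_one]

theorem one_add_mul_one_sub (i : Gen) {ε : ℤ} (hε : ε * ε = 1) :
    (1 + ε • ringGen i) * (1 - ε • ringGen i) = 0 := by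
  rw [mul_sub, mul_one, add_mul, one_mul, smul_mul_smul_comm, hε, ringGen_mul_self, one_smul]
  abel

/-- A character of `Γ` that is nontrivial on all generators. -/
theorem exists_parity : ∃ χ : Dinf → Prop, ∀ g i, χ (g * .of i) ↔ ¬ χ g := by
  let χ : Dinf →* ℤˣ := liftInvolutions (fun _ => -1) (fun _ => by simp)
  refine ⟨fun g => χ g = 1, fun g i => ?_⟩
  change χ (g * .of i) = 1 ↔ ¬ χ g = 1
  rw [map_mul, show χ (.of i) = -1 from liftInvolutions_of _ _ _]
  obtain h | h := Int.units_eq_one_or (χ g) <;> simp [h]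

/-- Each coset `{g, g s}` has exactly one element where the parity `χ` holds. The hypothesis reads
`x(g) = -ε x(g s)`, so `x` is recovered from its restriction to the half where `χ` holds, and this
restriction is the required `y`. -/
theorem exists_of_mul_eq_zero (i : Gen) (ε : ℤ) {x : ℤ[Dinf]}
    (hx : x * (1 + ε • ringGen i) = 0) : ∃ y, y * (1 - ε • ringGen i) = x := by
  classical
  obtain ⟨χ, hχ⟩ := exists_parity
  refine ⟨.ofCoeff (x.coeff.filter χ), ?_⟩
  ext g
  have h := congrArg (fun z => z.coeff g) hx
  simp only [mul_add, mul_one, mul_smul_comm, MonoidAlgebra.coeff_add, Finsupp.add_apply,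
    MonoidAlgebra.coeff_smul, Finsupp.smul_apply, coeff_mul_ringGen, MonoidAlgebra.coeff_zero,
    Finsupp.zero_apply, smul_eq_mul] at h
  simp only [mul_sub, mul_one, mul_smul_comm, MonoidAlgebra.coeff_sub, Finsupp.sub_apply,
    MonoidAlgebra.coeff_smul, Finsupp.smul_apply, coeff_mul_ringGen, smul_eq_mul,
    Finsupp.filter_apply, hχ]
  by_cases hg : χ g
  · simp [hg]
  · simp [hg]; linarith

/-- The derivation of `Γ` which sends a generator `s` to `1 - s` in the corresponding summand. -/
theorem exists_derivation : ∃ D : Dinf → Gen → ℤ[Dinf], ∀ g i,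
    D (g * .of i) = D g + Pi.single i (.single g 1 * (1 - ringGen i)) := by
  -- The usual Fox derivation, `s ↦ 1`, does not descend from the free group, as it sends `s²` to `1
  -- + s`. With the value `1 - s` it does, because `(1 + s)(1 - s) = 0`. The derivation is encoded
  -- by affine maps `m ↦ s m + D(s)`, and this says that they are involutions.
  have hinv : ∀ i : Gen, Function.Involutive fun m : Gen → ℤ[Dinf] =>
      (fun j => ringGen i * m j) + Pi.single i (1 - ringGen i) := by
    intro i m
    funext j
    by_cases hj : j = i
    · subst hj
      simp only [Pi.add_apply, Pi.single_eq_same, mul_add, ← mul_assoc, ringGen_mul_self,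
        mul_sub, one_mul, mul_one]
      abel
    · simp [Pi.single_eq_of_ne hj, ← mul_assoc, ringGen_mul_self]
  let θ : Dinf →* Equiv.Perm (Gen → ℤ[Dinf]) :=
    liftInvolutions (fun i => (hinv i).toPerm) fun i => Equiv.ext (hinv i)
  have hθ : ∀ i m, θ (.of i) m =
      (fun j => ringGen i * m j) + Pi.single i (1 - ringGen i) := fun i m => by
    rw [show θ (.of i) = (hinv i).toPerm from liftInvolutions_of _ _ _]; rfl
  -- `θ g` is affine with linear part left multiplication by `g`. Hence `g ↦ θ g 0` obeys the
  -- Leibniz rule `D(g h) = D(g) + g D(h)`.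
  have key : ∀ g m, θ g m = θ g 0 + fun j => .single g 1 * m j := by
    intro g
    induction g using dinf_induction with
    | one => intro m; rw [map_one]; funext j; simp [← MonoidAlgebra.one_def]
    | mul g i ih =>
      intro m
      rw [map_mul, Equiv.Perm.mul_apply, Equiv.Perm.mul_apply, ih, ih (θ (.of i) 0), hθ, hθ]
      funext j
      have hs : (MonoidAlgebra.single (g * .of i) 1 : ℤ[Dinf]) = .single g 1 * ringGen i := by
        rw [ringGen, MonoidAlgebra.single_mul_single, mul_one]
      simp only [Pi.add_apply, Pi.zero_apply, mul_add, hs, mul_assoc, mul_zero]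
      abel
  refine ⟨fun g => θ g 0, fun g i => ?_⟩
  change θ (g * .of i) 0 = _
  rw [map_mul, Equiv.Perm.mul_apply, key, hθ]
  congr 1
  funext j
  by_cases hj : j = i
  · subst hj; simp
  · simp [Pi.single_eq_of_ne hj]

/-- This is where the free product structure enters: a relation between the elements `s - 1` holds
separately for each generator. The additive extension `σ` of the derivation sends `y (s - 1)` to `y
(1 - s)` in the summand of `s`, so applying it to the relation separates the summands. -/
theorem mul_one_sub_eq_zero {x : Gen → ℤ[Dinf]} (hx : ∑ i, x i * (ringGen i - 1) = 0) (i : Gen) :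
    x i * (1 - ringGen i) = 0 := by
  obtain ⟨D, hD⟩ := exists_derivation
  let σ : ℤ[Dinf] →ₗ[ℤ] (Gen → ℤ[Dinf]) :=
    Finsupp.linearCombination ℤ D ∘ₗ (MonoidAlgebra.coeffLinearEquiv ℤ).toLinearMap
  have hσ : ∀ g (r : ℤ), σ (.single g r) = r • D g := fun g r => by
    simp [σ]
  have key : ∀ i (y : ℤ[Dinf]), σ (y * (ringGen i - 1)) = Pi.single i (y * (1 - ringGen i)) := by
    intro i y
    induction y using MonoidAlgebra.induction_linear with
    | zero => simp
    | add y z hy hz => rw [add_mul, map_add, hy, hz, add_mul, Pi.single_add]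
    | single g r =>
      have e : (MonoidAlgebra.single g r : ℤ[Dinf]) * (1 - ringGen i) =
          r • ((MonoidAlgebra.single g 1 : ℤ[Dinf]) * (1 - ringGen i)) := by
        rw [← smul_mul_assoc, MonoidAlgebra.smul_single, smul_eq_mul, mul_one]
      rw [mul_sub, mul_one, map_sub, ringGen, MonoidAlgebra.single_mul_single, mul_one, hσ, hσ,
        hD, smul_add, add_sub_cancel_left, ← ringGen, e]
      funext j
      by_cases hj : j = i
      · subst hj; simp
      · simp [Pi.single_eq_of_ne hj]
  have h := congrArg σ hx
  rw [map_sum, map_zero] at h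
  simp only [key] at h
  have h2 := congrFun h i
  rw [Finset.sum_apply, Finset.sum_eq_single i] at h2
  · simpa using h2
  · intro j _ hj; exact Pi.single_eq_of_ne hj.symm _
  · simp

/-- The elements `s - 1` generate the augmentation ideal, by telescoping: `g s - 1 = (g - 1) + g (s
- 1)`. -/
theorem exists_sum_mul_eq (g : Dinf) :
    ∃ z : Gen → ℤ[Dinf], ∑ i, z i * (ringGen i - 1) = .single g 1 - 1 := by
  induction g using dinf_induction with
  | one => exact ⟨0, by simp [MonoidAlgebra.one_def]⟩
  | mul g i ih =>
    obtain ⟨z, hz⟩ := ih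
    refine ⟨z + Pi.single i (.single g 1), ?_⟩
    simp only [Pi.add_apply, add_mul, Finset.sum_add_distrib, hz]
    rw [Finset.sum_eq_single i]
    · rw [Pi.single_eq_same, mul_sub, mul_one, ringGen, MonoidAlgebra.single_mul_single, mul_one]
      abel
    · intro j _ hj; rw [Pi.single_eq_of_ne hj, zero_mul]
    · simp

/-! ## A free resolution for the infinite dihedral group -/

open scoped MonoidAlgebra

/-- The map `e_i ↦ s_i - 1`. -/
noncomputable def fox₀ : (Representation.free ℤ Dinf Gen).IntertwiningMap
    (Representation.leftRegular ℤ Dinf) :=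
  Representation.freeLift _ fun i => ringGen i - 1

/-- The map `e_i ↦ (1 + ε s_i) e_i`. -/
noncomputable def fox (ε : ℤ) : (Representation.free ℤ Dinf Gen).IntertwiningMap
    (Representation.free ℤ Dinf Gen) :=
  Representation.freeLift _ fun i => Finsupp.single i (1 + ε • ringGen i)

theorem leftRegular_apply (g : Dinf) (x : ℤ[Dinf]) :
    Representation.leftRegular ℤ Dinf g x = .single g 1 * x := by
  induction x using MonoidAlgebra.induction_linear with
  | zero => simp
  | add y z hy hz => rw [map_add, hy, hz, mul_add]
  | single h r => simp [MonoidAlgebra.single_mul_single]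

theorem smul_single_one_mul (g : Dinf) (r : ℤ) (x : ℤ[Dinf]) :
    r • (MonoidAlgebra.single g 1 * x) = .single g r * x := by
  rw [← smul_mul_assoc, MonoidAlgebra.smul_single, smul_eq_mul, mul_one]

/-- Maps of free left modules are given by multiplication on the right. This formula and the one in
`fox_apply` reduce exactness of the resolution to identities in the group ring. -/
theorem fox₀_apply (f : Gen →₀ ℤ[Dinf]) : fox₀ f = ∑ i, f i * (ringGen i - 1) := by
  induction f using Finsupp.induction_linear with
  | zero => simp
  | add f g hf hg => rw [map_add, hf, hg, ← Finset.sum_add_distrib]; simp [add_mul]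
  | single i x =>
    rw [Finset.sum_eq_single i (fun j _ hj => by simp [Finsupp.single_eq_of_ne hj]) (by simp),
      Finsupp.single_eq_same]
    induction x using MonoidAlgebra.induction_linear with
    | zero => simp
    | add y z hy hz => rw [Finsupp.single_add, map_add, hy, hz, add_mul]
    | single g r =>
      rw [fox₀, Representation.freeLift_single_single, leftRegular_apply, smul_single_one_mul]

theorem fox_apply (ε : ℤ) (f : Gen →₀ ℤ[Dinf]) (i : Gen) :
    fox ε f i = f i * (1 + ε • ringGen i) := by
  induction f using Finsupp.induction_linear with
  | zero => simp
  | add f g hf hg => rw [map_add, Finsupp.add_apply, hf, hg, Finsupp.add_apply, add_mul]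
  | single j x =>
    induction x using MonoidAlgebra.induction_linear with
    | zero => simp
    | add y z hy hz =>
      rw [Finsupp.single_add, map_add, Finsupp.add_apply, hy, hz, Finsupp.add_apply, add_mul]
    | single g r =>
      rw [fox, Representation.freeLift_single_single, Finsupp.smul_apply,
        Representation.finsupp_single]
      by_cases hj : i = j
      · subst hj
        rw [Finsupp.single_eq_same, Finsupp.single_eq_same, leftRegular_apply,
          smul_single_one_mul]
      · simp [Finsupp.single_eq_of_ne hj]

theorem fox_comp (ε : ℤ) (hε : ε * ε = 1) (f : Gen →₀ ℤ[Dinf]) : fox ε (fox (-ε) f) = 0 := by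
  ext1 i
  have h := one_add_mul_one_sub i (ε := -ε) (by simpa using hε)
  rw [neg_smul, sub_neg_eq_add] at h
  rw [fox_apply, fox_apply, mul_assoc, neg_smul, h, mul_zero, Finsupp.zero_apply]

theorem fox₀_comp (f : Gen →₀ ℤ[Dinf]) : fox₀ (fox 1 f) = 0 := by
  rw [fox₀_apply]
  refine Finset.sum_eq_zero fun i _ => ?_
  have h := one_add_mul_one_sub i (ε := 1) rfl
  rw [one_smul] at h
  rw [fox_apply, one_smul, mul_assoc, ← neg_sub, mul_neg, h, neg_zero, mul_zero]

/-- `fox ε` is diagonal, so preimages can be chosen one coordinate at a time. -/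
theorem exists_fox_eq (ε : ℤ) {f : Gen →₀ ℤ[Dinf]} (hf : fox ε f = 0) :
    ∃ h, fox (-ε) h = f := by
  have H : ∀ i, ∃ y, y * (1 - ε • ringGen i) = f i := fun i =>
    exists_of_mul_eq_zero i ε (by rw [← fox_apply, hf, Finsupp.zero_apply])
  choose y hy using H
  refine ⟨Finsupp.equivFunOnFinite.symm y, ?_⟩
  ext1 i
  rw [fox_apply, neg_smul, ← sub_eq_add_neg]
  exact hy i

/-- The kernel of `fox₀` lies in the kernel of the diagonal map `fox (-1)`, by the separation of
summands in `mul_one_sub_eq_zero`. Exactness in degree one thereby becomes an instance of the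
periodic case. -/
theorem exists_fox_eq_of_fox₀ {f : Gen →₀ ℤ[Dinf]} (hf : fox₀ f = 0) : ∃ h, fox 1 h = f := by
  have H := exists_fox_eq (-1) (f := f) (by
    ext1 i
    rw [fox_apply, neg_smul, one_smul, ← sub_eq_add_neg, Finsupp.zero_apply]
    exact mul_one_sub_eq_zero (by rw [← fox₀_apply, hf]) i)
  rwa [neg_neg] at H

/-- The augmentation `ℤ[Γ] ⟶ ℤ`. -/
noncomputable def augmentation : (Representation.leftRegular ℤ Dinf).IntertwiningMap
    (Representation.trivial ℤ Dinf ℤ) where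
  toLinearMap := Finsupp.linearCombination ℤ (fun _ => 1) ∘ₗ
    (MonoidAlgebra.coeffLinearEquiv ℤ).toLinearMap
  isIntertwining' g := by ext; simp

theorem augmentation_single (g : Dinf) (r : ℤ) :
    augmentation (MonoidAlgebra.single g r) = r := by
  simp [augmentation]

theorem augmentation_fox₀ (f : Gen →₀ ℤ[Dinf]) : augmentation (fox₀ f) = 0 := by
  rw [fox₀_apply, map_sum]
  refine Finset.sum_eq_zero fun i _ => ?_
  induction f i using MonoidAlgebra.induction_linear with
  | zero => simp
  | add y z hy hz => rw [add_mul, map_add, hy, hz, add_zero]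
  | single g r =>
    rw [mul_sub, mul_one, map_sub, ringGen, MonoidAlgebra.single_mul_single, mul_one,
      augmentation_single, augmentation_single, sub_self]

theorem exists_fox₀_eq {x : ℤ[Dinf]} (hx : augmentation x = 0) : ∃ f, fox₀ f = x := by
  -- The condition of zero augmentation is not preserved by splitting `x` into monomials.
  -- Subtracting the augmentation gives a statement that is additive in `x` and needs no hypothesis.
  have H : ∃ f, fox₀ f = x - .single 1 (augmentation x) := by
    clear hx
    induction x using MonoidAlgebra.induction_linear with
    | zero => exact ⟨0, by simp⟩
    | add y z hy hz =>
      obtain ⟨f, hf⟩ := hy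
      obtain ⟨h, hh⟩ := hz
      refine ⟨f + h, ?_⟩
      rw [map_add, hf, hh, map_add, MonoidAlgebra.single_add]
      abel
    | single g r =>
      obtain ⟨z, hz⟩ := exists_sum_mul_eq g
      refine ⟨r • Finsupp.equivFunOnFinite.symm z, ?_⟩
      rw [map_smul, fox₀_apply, augmentation_single]
      refine (congrArg (r • ·) hz).trans ?_
      simp [smul_sub, MonoidAlgebra.one_def]
  obtain ⟨f, hf⟩ := H
  exact ⟨f, by rw [hf, hx, MonoidAlgebra.single_zero, sub_zero]⟩

/-- The free modules of the resolution. -/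
noncomputable def resolutionX : ℕ → Rep ℤ Dinf
  | 0 => Rep.leftRegular ℤ Dinf
  | _ + 1 => Rep.free ℤ Dinf Gen

/-- The differentials of the resolution. -/
noncomputable def resolutionDiff : ∀ n, resolutionX (n + 1) ⟶ resolutionX n
  | 0 => Rep.ofHom fox₀
  -- The sign is `+` in the map from degree two to degree one, since it precedes `s - 1` and `(1 +
  -- s)(s - 1) = 0`.
  | n + 1 => Rep.ofHom (fox ((-1) ^ n))

theorem resolutionDiff_comp (n : ℕ) : resolutionDiff (n + 1) ≫ resolutionDiff n = 0 := by
  cases n with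
  | zero =>
    refine Rep.hom_ext (Representation.IntertwiningMap.ext ?_)
    exact LinearMap.ext fun f => fox₀_comp f
  | succ n =>
    refine Rep.hom_ext (Representation.IntertwiningMap.ext (LinearMap.ext fun f => ?_))
    change fox ((-1) ^ n) (fox ((-1) ^ (n + 1)) f) = 0
    rw [pow_succ, mul_neg_one]
    exact fox_comp _ (by rw [← mul_pow]; simp) f

/-- The complex `⋯ ⟶ ℤ[Γ]² ⟶ ℤ[Γ]² ⟶ ℤ[Γ]`. -/
noncomputable def resolutionComplex : ChainComplex (Rep ℤ Dinf) ℕ :=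
  ChainComplex.of resolutionX resolutionDiff resolutionDiff_comp

theorem resolutionComplex_d (n : ℕ) : resolutionComplex.d (n + 1) n = resolutionDiff n :=
  ChainComplex.of_d _ _ _

/-- The augmentation of the resolution. -/
noncomputable def resolutionπ : resolutionComplex ⟶
    (ChainComplex.single₀ (Rep ℤ Dinf)).obj (Rep.trivial ℤ Dinf ℤ) :=
  (resolutionComplex.toSingle₀Equiv _).symm
    ⟨Rep.ofHom augmentation, by
      rw [resolutionComplex_d]
      refine Rep.hom_ext (Representation.IntertwiningMap.ext ?_)
      exact LinearMap.ext fun f => augmentation_fox₀ f⟩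

/-- The forgetful functor to modules reflects exactness, so exactness of representations can be
checked on elements. -/
theorem rep_exact {k G : Type u} [CommRing k] [Group G] (S : ShortComplex (Rep.{u} k G))
    (h : ∀ x, S.g.hom x = 0 → ∃ y, S.f.hom y = x) : S.Exact := by
  apply (forget₂ (Rep.{u} k G) (ModuleCat.{u} k)).reflects_exact_of_faithful
  rw [ShortComplex.moduleCat_exact_iff]
  exact h

theorem resolutionπ_f_zero : resolutionπ.f 0 = Rep.ofHom augmentation :=
  ChainComplex.toSingle₀Equiv_symm_apply_f_zero _ _

theorem resolution_quasiIso : QuasiIso resolutionπ where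
  quasiIsoAt m := by
    cases m with
    | zero =>
      -- In degree zero a quasi-isomorphism to `ℤ` amounts to exactness of `ℤ[Γ]² ⟶ ℤ[Γ] ⟶ ℤ` in the
      -- middle and surjectivity of the augmentation. In positive degrees the target is exact, so
      -- only exactness of the resolution is left.
      rw [ChainComplex.quasiIsoAt₀_iff, ShortComplex.quasiIso_iff_of_zeros' _ rfl rfl rfl]
      constructor
      · refine rep_exact _ fun x hx => ?_
        change (resolutionπ.f 0).hom x = 0 at hx
        change ∃ y, (resolutionComplex.d 1 0).hom y = x
        rw [resolutionπ_f_zero] at hx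
        rw [resolutionComplex_d]
        exact exists_fox₀_eq hx
      · rw [Rep.epi_iff_surjective]
        intro x
        change ∃ y, (resolutionπ.f 0).hom y = x
        rw [resolutionπ_f_zero]
        exact ⟨_, augmentation_single 1 x⟩
    | succ m =>
      rw [quasiIsoAt_iff_exactAt' (hL := ChainComplex.exactAt_succ_single_obj ..),
          HomologicalComplex.exactAt_iff' _ (m + 2) (m + 1) m (by simp) (by simp)]
      refine rep_exact _ fun x hx => ?_
      change (resolutionComplex.d (m + 1) m).hom x = 0 at hx
      change ∃ y, (resolutionComplex.d (m + 1 + 1) (m + 1)).hom y = x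
      rw [resolutionComplex_d] at hx ⊢
      cases m with
      | zero => exact exists_fox_eq_of_fox₀ hx
      | succ m =>
        obtain ⟨y, hy⟩ := exists_fox_eq _ hx
        refine ⟨y, Eq.trans ?_ hy⟩
        change fox ((-1) ^ (m + 1)) y = _
        rw [pow_succ, mul_neg_one]

/-- The resolution of the trivial module. -/
noncomputable def resolution : ProjectiveResolution (Rep.trivial ℤ Dinf ℤ) where
  complex := resolutionComplex
  projective n := by
    cases n with
    | zero => exact inferInstanceAs (Projective (Rep.leftRegular ℤ Dinf))
    | succ n => exact inferInstanceAs (Projective (Rep.free ℤ Dinf Gen))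
  π := resolutionπ
  quasiIso := resolution_quasiIso

/-! ## Group homology of the infinite dihedral group -/

open scoped MonoidAlgebra TensorProduct

/-- If `N • x` is a boundary for every cycle `x` of degree `n + 1`, then `N` annihilates the
homology in this degree. -/
theorem nsmul_homology_eq_zero (K : ChainComplex (ModuleCat.{u} ℤ) ℕ) (n N : ℕ)
    (h : ∀ x : K.X (n + 1), K.d (n + 1) n x = 0 → ∃ y : K.X (n + 2), K.d (n + 2) (n + 1) y = N • x)
    (z : K.homology (n + 1)) : N • z = 0 := by
  obtain ⟨c, rfl⟩ := (ModuleCat.epi_iff_surjective (K.homologyπ (n + 1))).1 inferInstance z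
  have hc : K.d (n + 1) n (K.iCycles (n + 1) c) = 0 := by
    rw [← ModuleCat.comp_apply, K.iCycles_d]; rfl
  obtain ⟨y, hy⟩ := h _ hc
  -- An equality of cycles can be tested on the underlying chains, where it is `hy`.
  have : K.toCycles (n + 2) (n + 1) y = N • c := by
    apply (ModuleCat.mono_iff_injective (K.iCycles (n + 1))).1 inferInstance
    rw [← ModuleCat.comp_apply, K.toCycles_i, hy, map_nsmul]
  rw [← map_nsmul, ← this, ← ModuleCat.comp_apply, K.toCycles_comp_homologyπ]
  rfl

open Representation in
-- In the coinvariants of `A ⊗ k[G]^α` the class of `a ⊗ g e_j` equals that of `g⁻¹ a ⊗ e_j`. Right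
-- multiplication by `s` on the free module therefore turns into the action of `s⁻¹` on `A`.
theorem coinvariantsTensor_map_single {k G α : Type u} [CommRing k] [Group G] [DecidableEq α]
    (A : Rep.{u} k G) (φ : Rep.free k G α ⟶ Rep.free k G α) (a : A) (j : α) (s : G) (ε : k)
    (h : φ.hom (Finsupp.single j (MonoidAlgebra.single 1 1)) =
      Finsupp.single j (MonoidAlgebra.single 1 1) + Finsupp.single j (MonoidAlgebra.single s ε)) :
    Rep.coinvariantsTensorFreeLEquiv A α (((Rep.coinvariantsTensor k G).obj A).map φ
      ((Rep.coinvariantsTensorFreeLEquiv A α).symm (Finsupp.single j a))) =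
      Finsupp.single j (a + ε • A.ρ s⁻¹ a) := by
  have h1 : (Rep.coinvariantsTensorFreeLEquiv A α).symm (Finsupp.single j a) =
      Coinvariants.mk (A.ρ.tprod (free k G α))
        (a ⊗ₜ[k] Finsupp.single j (MonoidAlgebra.single 1 1)) :=
    Rep.finsuppToCoinvariantsTensorFree_single j a
  have h2 : ((Rep.coinvariantsTensor k G).obj A).map φ
      ((Rep.coinvariantsTensorFreeLEquiv A α).symm (Finsupp.single j a)) =
      Coinvariants.mk (A.ρ.tprod (free k G α))
        (a ⊗ₜ[k] φ.hom (Finsupp.single j (MonoidAlgebra.single 1 1))) := by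
    rw [h1]; rfl
  have h4 : ∀ (g : G) (r : k), Rep.coinvariantsTensorFreeLEquiv A α
      (Coinvariants.mk (A.ρ.tprod (free k G α))
        (a ⊗ₜ[k] Finsupp.single j (MonoidAlgebra.single g r))) =
      Finsupp.single j (r • A.ρ g⁻¹ a) := fun g r =>
    Rep.coinvariantsTensorFreeToFinsupp_mk_tmul_single A a j g r
  rw [h2, h, TensorProduct.tmul_add, map_add, map_add, h4, h4, ← Finsupp.single_add]
  simp

variable (A : Rep.{0} ℤ Dinf)

/-- After tensoring with `A`, the differentials between terms of positive degree are diagonal: the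
complex splits there into one periodic complex for each generator. The inverse disappears because
the generators are involutions. -/
theorem free_tensor_apply (ε : ℤ) (z : (((Rep.coinvariantsTensor ℤ Dinf).obj A).obj
      (Rep.free ℤ Dinf Gen) : ModuleCat ℤ)) (i : Gen) :
    Rep.coinvariantsTensorFreeLEquiv A Gen
      (((Rep.coinvariantsTensor ℤ Dinf).obj A).map (Rep.ofHom (fox ε)) z) i =
      Rep.coinvariantsTensorFreeLEquiv A Gen z i +
        ε • A.ρ (.of i) (Rep.coinvariantsTensorFreeLEquiv A Gen z i) := by
  obtain ⟨y, rfl⟩ := (Rep.coinvariantsTensorFreeLEquiv A Gen).symm.surjective z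
  rw [LinearEquiv.apply_symm_apply]
  induction y using Finsupp.induction_linear with
  | zero => simp
  | add y y' h h' =>
    simp only [map_add, Finsupp.add_apply, smul_add] at h h' ⊢
    rw [h, h']; abel
  | single j a =>
    rw [coinvariantsTensor_map_single A _ a j (.of j) ε, of_inv]
    · by_cases hj : i = j
      · subst hj
        rw [Finsupp.single_eq_same, Finsupp.single_eq_same]
        -- The module structure carried by `A` and the integer multiples of its additive group are
        -- different instances of the same operation.
        exact congrArg _ (int_smul_eq_zsmul A.hV2 ε _)
      · simp [Finsupp.single_eq_of_ne hj]
    · refine Finsupp.ext fun i => ?_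
      refine (fox_apply ε _ i).trans ?_
      by_cases hj : i = j
      · subst hj
        simp [ringGen, ← MonoidAlgebra.one_def]
      · simp [Finsupp.single_eq_of_ne hj]

/-- A criterion for `N` to annihilate the homology of `Γ` in degree `n + 2`. -/
theorem nsmul_groupHomology_eq_zero (n N : ℕ)
    (h : ∀ i (x : A), x + (-1 : ℤ) ^ n • A.ρ (.of i) x = 0 →
      ∃ y : A, y - (-1 : ℤ) ^ n • A.ρ (.of i) y = N • x)
    (z : groupHomology A (n + 2)) : N • z = 0 := by
  let e := groupHomologyIso A (n + 2) resolution
  apply (ModuleCat.mono_iff_injective e.hom).1 inferInstance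
  rw [map_nsmul, map_zero]
  refine nsmul_homology_eq_zero _ (n + 1) N (fun x hx => ?_) (e.hom z)
  let F := (Rep.coinvariantsTensor ℤ Dinf).obj A
  let E := Rep.coinvariantsTensorFreeLEquiv A Gen
  change F.map (resolutionComplex.d (n + 2) (n + 1)) x = 0 at hx
  change ∃ y, F.map (resolutionComplex.d (n + 3) (n + 2)) y = _
  -- Both differentials at degree `n + 2` are of the form `fox`, with signs `(-1) ^ n` and `(-1) ^
  -- (n + 1)`. This is why the criterion starts in degree two: below it the map `fox₀` mixes the
  -- generators.
  rw [resolutionComplex_d] at hx ⊢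
  have H : ∀ i, ∃ y : A, y - (-1 : ℤ) ^ n • A.ρ (.of i) y = N • E x i := by
    intro i
    refine h i _ ((free_tensor_apply A _ x i).symm.trans ?_)
    have := congrArg (fun z => E z i) hx
    exact this.trans (DFunLike.congr_fun (map_zero E) i)
  choose y hy using H
  refine ⟨E.symm (Finsupp.equivFunOnFinite.symm y), E.injective (Finsupp.ext fun i => ?_)⟩
  refine (free_tensor_apply A ((-1) ^ (n + 1)) _ i).trans ?_
  rw [pow_succ, mul_neg_one, neg_smul, ← sub_eq_add_neg]
  have e1 : E (E.symm (Finsupp.equivFunOnFinite.symm y)) i = y i :=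
    DFunLike.congr_fun (E.apply_symm_apply _) i
  have e2 : E (N • x) i = N • E x i := DFunLike.congr_fun (map_nsmul E N x) i
  refine Eq.trans ?_ ((hy i).trans e2.symm)
  rw [← e1]

/-! ## The kernel groupoid as a transformation groupoid -/

/-- `act_eq` gives this form only for the homeomorphisms by which `Γ` acts. Faithfulness requires it
in the abstract group, where `b = (a b)⁻¹ a`. -/
theorem dinf_normal_form (g : Dinf) : ∃ n : ℤ, g = (.of .a * .of .b : Dinf) ^ n ∨
    g = (.of .a * .of .b : Dinf) ^ n * .of .a := by
  have hb : (.of .b : Dinf) = (.of .a * .of .b : Dinf)⁻¹ * .of .a := by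
    rw [mul_inv_rev, of_inv, of_inv, mul_assoc, of_mul_of, mul_one]
  induction g using dinf_induction with
  | one => exact ⟨0, .inl (zpow_zero _).symm⟩
  | mul g i ih =>
    obtain ⟨n, rfl | rfl⟩ := ih <;> cases i
    · exact ⟨n, .inr rfl⟩
    · refine ⟨n - 1, .inr ?_⟩
      rw [zpow_sub_one, mul_assoc, ← hb]
    · exact ⟨n, .inl (by rw [mul_assoc, of_mul_of, mul_one])⟩
    · exact ⟨n + 1, .inl (by rw [mul_assoc, zpow_add_one])⟩

theorem rot_zpow_eq_one {n : ℤ} (h : rot ^ n = 1) : n = 0 :=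
  rot_zpow_free _ n 0 le_rfl (by rw [h]; rfl)

/-- The action of `Γ` is faithful. -/
theorem act_injective : Function.Injective act := by
  refine (injective_iff_map_eq_one act).2 fun g hg => ?_
  have hr : ∀ n : ℤ, act ((.of .a * .of .b : Dinf) ^ n) = rot ^ n := fun n => by
    rw [map_zpow, map_mul]; rfl
  obtain ⟨n, rfl | rfl⟩ := dinf_normal_form g
  · rw [hr] at hg
    rw [rot_zpow_eq_one hg, zpow_zero]
  · exfalso
    rw [map_mul, hr] at hg
    -- If `(a b)ⁿ a` acted trivially, `a` would be a power of `rot`. As `a² = 1` and `rot` has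
    -- infinite order, `a` would then act trivially, although it has no fixed point.
    have h1 : act (.of .a) = rot ^ (-n) := by
      rw [zpow_neg]; exact (inv_eq_of_mul_eq_one_right hg).symm
    have h2 := actA_sq
    rw [h1, ← zpow_add] at h2
    have h3 := rot_zpow_eq_one h2
    rw [show -n = 0 by omega, zpow_zero] at h1
    exact actA_no_fix 0 (by rw [h1]; rfl)

/-- Every `g ∈ Γ` is the restriction to the letter `0` of an element of `Γ` that fixes `0`. -/
theorem exists_act_zero (g : Dinf) : ∃ h, ∀ x, act h (consWord 0 x) = consWord 0 (act g x) := by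
  induction g using dinf_induction with
  | one => exact ⟨1, fun x => by rw [map_one]; rfl⟩
  | mul g i ih =>
    obtain ⟨h, H⟩ := ih
    cases i
    -- Both `b` and `a b a` fix the letter `0`, and their restrictions to it are `a` and `b`
    -- respectively. So both generators arise as restrictions.
    · exact ⟨h * .of .b, fun x => by rw [act_mul_apply, act_b_zero, H, act_mul_apply]⟩
    · exact ⟨h * (.of .a * .of .b * .of .a), fun x => by
        simp only [act_mul_apply, act_a_zero, act_b_one, act_a_one, H]⟩

/-- The generator `a` exchanges the letters with trivial restriction. Composing with it on either
side moves the case `c = d = 0` to all other pairs of letters. -/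
theorem exists_act_letter (c d : Fin 2) (g : Dinf) :
    ∃ h, ∀ x, act h (consWord c x) = consWord d (act g x) := by
  obtain ⟨h, H⟩ := exists_act_zero g
  obtain rfl | rfl : c = 0 ∨ c = 1 := by omega
  · obtain rfl | rfl : d = 0 ∨ d = 1 := by omega
    · exact ⟨h, H⟩
    · exact ⟨.of .a * h, fun x => by rw [act_mul_apply, H, act_a_zero]⟩
  · obtain rfl | rfl : d = 0 ∨ d = 1 := by omega
    · exact ⟨h * .of .a, fun x => by rw [act_mul_apply, act_a_one, H]⟩
    · exact ⟨.of .a * h * .of .a, fun x => by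
        rw [act_mul_apply, act_a_one, act_mul_apply, H, act_a_zero]⟩

/-- For words of the same length, `S_(α,g,β)` is the restriction of the action of an element. -/
theorem exists_act_prepend (g : Dinf) : ∀ {α β : List (Fin 2)}, α.length = β.length →
    ∃ h, ∀ x, act h (prepend β x) = prepend α (act g x)
  | [], [], _ => ⟨g, fun _ => rfl⟩
  | d :: α, c :: β, hl => by
    obtain ⟨h', H'⟩ := exists_act_prepend g (α := α) (β := β) (by simpa using hl)
    obtain ⟨h, H⟩ := exists_act_letter c d h'
    exact ⟨h, fun x => by rw [prepend, H, H']; rfl⟩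

theorem localHomeo_nil (g : Dinf) (x : InfWord) : localHomeo ⟨[], g, []⟩ x = act g x :=
  localHomeo_apply ⟨[], g, []⟩ x

/-- The arrow with range `x` that is given by `g ∈ Γ`. -/
def arrow (g : Dinf) (x : InfWord) : {γ : Arrow // cocycle γ = 0} :=
  ⟨germ ⟨[], g, []⟩ (act g⁻¹ x) ⟨_, rfl⟩, rfl⟩

theorem src_arrow (g : Dinf) (x : InfWord) : kernelGroupoid.src (arrow g x) = act g⁻¹ x := rfl

theorem rng_arrow (g : Dinf) (x : InfWord) : kernelGroupoid.rng (arrow g x) = x :=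
  (localHomeo_nil g _).trans (act_apply_inv g x)

/-- This is surjectivity of `Γ × X^∞ → ℋ`. The vanishing of the cocycle means `|α| = |β|`, and then
`S_(α,g,β)` coincides on the whole cylinder `Z(β)` with the action of an element of `Γ`. -/
theorem exists_arrow (γ : {γ : Arrow // cocycle γ = 0}) :
    ∃ g, γ = arrow g (kernelGroupoid.rng γ) := by
  obtain ⟨γ, hγ⟩ := γ
  obtain ⟨t, x, hx, rfl⟩ := exists_germ γ
  rw [cocycle_germ] at hγ
  obtain ⟨h, H⟩ := exists_act_prepend t.elt (α := t.left) (β := t.right) (by omega)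
  have hloc : localHomeo t =ᶠ[𝓝 x] localHomeo ⟨[], h, []⟩ := by
    filter_upwards [cyl_mem_nhds hx]
    rintro _ ⟨y, rfl⟩
    rw [localHomeo_nil, H, localHomeo_apply]
  refine ⟨h, Subtype.ext (germ_eq_iff.2 ⟨?_, hloc⟩)⟩
  change x = act h⁻¹ (localHomeo t x)
  rw [hloc.eq_of_nhds, localHomeo_nil, act_inv_apply]

/-- The action is not free, since `b` fixes `1^∞`, but germs still separate group elements:
agreement on a nonempty open set forces equal actions by `rigid`, and the action is faithful. -/
theorem arrow_injective {g h : Dinf} {x y : InfWord} (H : arrow g x = arrow h y) : g = h := by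
  obtain ⟨-, h2⟩ := germ_eq_iff.1 (Subtype.ext_iff.1 H)
  obtain ⟨V, hV, hVo, hxV⟩ := eventually_nhds_iff.1 h2
  exact act_injective (rigid (p := []) (q := []) hVo ⟨_, hxV⟩ fun z hz => by
    have := hV z hz
    rwa [localHomeo_nil, localHomeo_nil] at this).2

theorem continuous_arrow (g : Dinf) : Continuous (arrow g) := by
  refine Continuous.subtype_mk ?_ _
  have h := continuousOn_sec ⟨[], g, []⟩
  rw [show cyl [] = Set.univ from Set.range_id, continuousOn_univ] at h
  convert h.comp (act g⁻¹).continuous using 1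
  funext x
  exact (sec_eq (t := ⟨[], g, []⟩) ⟨_, rfl⟩).symm

theorem mul_arrow (g h : Dinf) (x : InfWord) :
    kernelGroupoid.mul (arrow g x) (arrow h (act g⁻¹ x)) = arrow (g * h) x := by
  have hc : src (arrow g x).1 = rng (arrow h (act g⁻¹ x)).1 := (rng_arrow h _).symm
  have h1 : (kernelGroupoid.mul (arrow g x) (arrow h (act g⁻¹ x))).1 =
      mul (arrow g x).1 (arrow h (act g⁻¹ x)).1 :=
    congrArg Subtype.val (dif_pos hc)
  apply Subtype.ext
  rw [h1]
  refine mul_eq ⟨⟨[], g, []⟩, ⟨[], h, []⟩, ⟨[], g * h, []⟩, act h⁻¹ (act g⁻¹ x), ⟨_, rfl⟩, ⟨_, rfl⟩,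
    ⟨_, rfl⟩, germ_eq_iff.2 ⟨?_, .refl _ _⟩, rfl, germ_eq_iff.2 ⟨?_, .refl _ _⟩,
    Filter.Eventually.of_forall fun y => ?_⟩
  · rw [localHomeo_nil, act_apply_inv]
  · rw [mul_inv_rev, act_mul_apply]
  · rw [Function.comp, localHomeo_nil, localHomeo_nil, localHomeo_nil, act_mul_apply]

/-! ## Composable strings -/

/-- The string with arrows given by `g` and first vertex `x`. -/
def stringOf {n : ℕ} (g : Fin n → Dinf) (x : InfWord) : kernelGroupoid.Strings n :=
  -- The `k`-th vertex is `(g₁ ⋯ gₖ)⁻¹ x`, because the source of each arrow is the range of the next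
  -- one.
  ⟨(fun k => act (Fin.partialProd g k)⁻¹ x,
    fun j => arrow (g j) (act (Fin.partialProd g j.castSucc)⁻¹ x)), fun j => by
      refine ⟨rng_arrow _ _, ?_⟩
      dsimp only
      rw [src_arrow, Fin.partialProd_succ, mul_inv_rev, act_mul_apply]⟩

theorem stringOf_first {n : ℕ} (g : Fin n → Dinf) (x : InfWord) : (stringOf g x).1.1 0 = x := by
  change act (Fin.partialProd g 0)⁻¹ x = x
  rw [Fin.partialProd_zero, inv_one, map_one]; rfl

/-- A string is determined by the group elements of its arrows and its first vertex. -/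
theorem eq_stringOf {n : ℕ} {p : kernelGroupoid.Strings n} {g : Fin n → Dinf}
    (h : ∀ j, ∃ y, p.1.2 j = arrow (g j) y) : p = stringOf g (p.1.1 0) := by
  have h' : ∀ j, p.1.2 j = arrow (g j) (p.1.1 j.castSucc) := fun j => by
    obtain ⟨y, hy⟩ := h j
    rw [← (p.2 j).1, hy, rng_arrow]
  have hv : ∀ k, p.1.1 k = act (Fin.partialProd g k)⁻¹ (p.1.1 0) := by
    intro k
    induction k using Fin.induction with
    | zero => rw [Fin.partialProd_zero, inv_one, map_one]; rfl
    | succ j ih =>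
      rw [← (p.2 j).2, h', src_arrow, ih, Fin.partialProd_succ, mul_inv_rev, act_mul_apply]
  refine Subtype.ext (Prod.ext (funext hv) (funext fun j => ?_))
  rw [h', hv]
  rfl

theorem exists_eq_stringOf {n : ℕ} (p : kernelGroupoid.Strings n) :
    ∃ g, p = stringOf g (p.1.1 0) := by
  choose g hg using fun j => exists_arrow (p.1.2 j)
  exact ⟨g, eq_stringOf fun j => ⟨_, hg j⟩⟩

theorem stringOf_injective {n : ℕ} {g h : Fin n → Dinf} {x y : InfWord}
    (H : stringOf g x = stringOf h y) : g = h ∧ x = y := by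
  refine ⟨funext fun j => arrow_injective (congrFun (congrArg (fun p => p.1.2) H) j), ?_⟩
  rw [← stringOf_first g x, H, stringOf_first]

theorem continuous_stringOf {n : ℕ} (g : Fin n → Dinf) : Continuous (stringOf g) :=
  Continuous.subtype_mk ((continuous_pi fun _ => (act _).continuous).prodMk
    (continuous_pi fun j => (continuous_arrow (g j)).comp (act _).continuous)) _

/-- A continuous section of a local homeomorphism is itself a local homeomorphism; here it is a
section of the first vertex map. -/
theorem isLocalHomeomorph_stringOf {n : ℕ} (g : Fin n → Dinf) :
    IsLocalHomeomorph (stringOf g) := by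
  refine IsLocalHomeomorph.of_comp ?_ (kernelGroupoid.isLocalHomeomorph_first n)
    (continuous_stringOf g)
  rw [show (fun p : kernelGroupoid.Strings n => p.1.1 0) ∘ stringOf g = id from
    funext (stringOf_first g)]
  exact (Homeomorph.refl _).isLocalHomeomorph

/-- These faces keep the first vertex, so by `eq_stringOf` only the group elements have to be
compared. For the last index `contractNth` drops the last entry, in agreement with the last face. -/
theorem face_succ_stringOf {n : ℕ} (i : Fin (n + 1)) (g : Fin (n + 1) → Dinf) (x : InfWord) :
    kernelGroupoid.face i.succ (stringOf g x) = stringOf (i.contractNth (· * ·) g) x := by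
  have h0 : (kernelGroupoid.face i.succ (stringOf g x)).1.1 0 = x := by
    change (stringOf g x).1.1 (i.succ.succAbove 0) = x
    rw [Fin.succ_succAbove_zero, stringOf_first]
  conv_rhs => rw [← h0]
  refine eq_stringOf fun j => ?_
  simp only [EtaleGroupoid.face, Fin.contractNth, Fin.val_succ, add_lt_add_iff_right,
    add_left_inj]
  split_ifs
  · exact ⟨_, rfl⟩
  · refine ⟨act (Fin.partialProd g j.castSucc.castSucc)⁻¹ x,
      Eq.trans ?_ (mul_arrow (g j.castSucc) (g j.succ) _)⟩
    change kernelGroupoid.mul (arrow _ _)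
      (arrow _ (act (Fin.partialProd g j.succ.castSucc)⁻¹ x)) = _
    rw [← Fin.succ_castSucc, Fin.partialProd_succ, mul_inv_rev, act_mul_apply]
  · exact ⟨_, rfl⟩

/-- Deleting the first arrow moves the first vertex to `g₁⁻¹ x`. This is the source of the twist of
the coefficient by `g₁⁻¹` in the differential of inhomogeneous chains. -/
theorem face_zero_stringOf {n : ℕ} (g : Fin (n + 1) → Dinf) (x : InfWord) :
    kernelGroupoid.face 0 (stringOf g x) = stringOf (fun j => g j.succ) (act (g 0)⁻¹ x) := by
  have h0 : (kernelGroupoid.face 0 (stringOf g x)).1.1 0 = act (g 0)⁻¹ x := by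
    change act (Fin.partialProd g (Fin.succ 0))⁻¹ x = _
    rw [Fin.partialProd_succ, Fin.castSucc_zero, Fin.partialProd_zero, one_mul]
  conv_rhs => rw [← h0]
  refine eq_stringOf fun j => ?_
  simp only [EtaleGroupoid.face]
  exact ⟨_, rfl⟩

end DihedralGroupoid

/-! ### Push-forward along injective maps and along the identity. -/

section PushForward

variable {X Y : Type*} [TopologicalSpace X] [TopologicalSpace Y] [T2Space X] [T2Space Y]

theorem pushforward_apply_of_injective {π : X → Y} (hπ : IsLocalHomeomorph π)
    (hinj : Function.Injective π) (f : C_c(X, ℤ)) (x : X) : pushforward π hπ f (π x) = f x := by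
  rw [pushforward_apply, show π ⁻¹' {π x} = {x} from Set.ext fun _ => hinj.eq_iff,
    finsum_mem_singleton]

theorem pushforward_apply_of_notMem {π : X → Y} (hπ : IsLocalHomeomorph π) (f : C_c(X, ℤ)) {y : Y}
    (hy : y ∉ Set.range π) : pushforward π hπ f y = 0 := by
  rw [pushforward_apply]
  exact finsum_mem_eq_zero_of_forall_eq_zero fun x hx => absurd ⟨x, hx⟩ hy

theorem pushforward_id (h : IsLocalHomeomorph (id : X → X)) : pushforward id h = LinearMap.id := by
  ext f x
  exact pushforward_apply_of_injective h Function.injective_id f x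

end PushForward

namespace DihedralGroupoid

/-! ## The chain complex of the kernel groupoid -/

/-- The action of `Γ` on the functions on `X^∞`. -/
noncomputable def funRep : Representation ℤ Dinf C_c(InfWord, ℤ) where
  toFun g := pushforward (act g) (act g).isLocalHomeomorph
  map_one' := by
    have : ⇑(act 1) = id := by rw [map_one]; rfl
    simp only [this]
    exact pushforward_id _
  map_mul' g h := (pushforward_comp _ _ _ (funext fun x => (act_mul_apply g h x).symm)).symm

theorem funRep_apply (g : Dinf) (f : C_c(InfWord, ℤ)) (x : InfWord) :
    funRep g f x = f (act g⁻¹ x) := by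
  conv_lhs => rw [← act_apply_inv g x]
  exact pushforward_apply_of_injective (act g).isLocalHomeomorph (act g).injective f _

/-- The identification of inhomogeneous chains with functions on strings. -/
noncomputable def chainMap (n : ℕ) :
    ((Fin n → Dinf) →₀ C_c(InfWord, ℤ)) →ₗ[ℤ] C_c(kernelGroupoid.Strings n, ℤ) :=
  Finsupp.lsum ℤ fun g => pushforward (stringOf g) (isLocalHomeomorph_stringOf g)

theorem chainMap_single {n : ℕ} (g : Fin n → Dinf) (m : C_c(InfWord, ℤ)) :
    chainMap n (Finsupp.single g m) = pushforward (stringOf g) (isLocalHomeomorph_stringOf g) m :=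
  Finsupp.lsum_single _ _ _ _

/-- The images of `stringOf g` for different `g` are disjoint, so evaluation on one of them sees a
single coordinate. -/
theorem chainMap_apply {n : ℕ} (f : (Fin n → Dinf) →₀ C_c(InfWord, ℤ)) (g : Fin n → Dinf)
    (x : InfWord) : chainMap n f (stringOf g x) = f g x := by
  induction f using Finsupp.induction_linear with
  | zero => simp
  | add f f' h h' => rw [map_add, Finsupp.add_apply]; exact congrArg₂ (· + ·) h h'
  | single h m =>
    rw [chainMap_single]
    by_cases hg : g = h
    · subst hg
      rw [Finsupp.single_eq_same]
      exact pushforward_apply_of_injective _ (fun _ _ H => (stringOf_injective H).2) m x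
    · rw [Finsupp.single_eq_of_ne hg]
      refine pushforward_apply_of_notMem _ m ?_
      rintro ⟨y, hy⟩
      exact hg (stringOf_injective hy).1.symm

/-- The images of the maps `stringOf g` partition the space of strings into open copies of `X^∞`. A
compact support meets only finitely many of them, which yields the finitely supported family of
coefficients. -/
theorem chainMap_bijective (n : ℕ) : Function.Bijective (chainMap n) := by
  constructor
  · intro f f' h
    refine Finsupp.ext fun g => ?_
    ext x
    rw [← chainMap_apply, h, chainMap_apply]
  · intro F
    obtain ⟨t, ht⟩ := F.hasCompactSupport.elim_finite_subcover
      (fun g : Fin n → Dinf => Set.range (stringOf g))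
      (fun g => (isLocalHomeomorph_stringOf g).isOpenMap.isOpen_range) (fun p _ => by
        obtain ⟨g, hg⟩ := exists_eq_stringOf p
        exact Set.mem_iUnion.2 ⟨g, _, hg.symm⟩)
    let m : (Fin n → Dinf) → C_c(InfWord, ℤ) := fun g =>
      { toFun := fun x => F (stringOf g x)
        continuous_toFun := F.continuous.comp (continuous_stringOf g)
        hasCompactSupport' := HasCompactSupport.of_compactSpace _ }
    refine ⟨Finsupp.onFinset t (fun g => m g) fun g hg => ?_, ?_⟩
    · by_contra hgt
      apply hg
      ext x
      change F (stringOf g x) = 0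
      by_contra hne
      obtain ⟨h, hh, y, hy⟩ := Set.mem_iUnion₂.1 (ht (subset_tsupport F hne))
      exact hgt ((stringOf_injective hy).1 ▸ hh)
    · ext p
      obtain ⟨g, hg⟩ := exists_eq_stringOf p
      rw [hg, chainMap_apply]
      rfl

theorem boundary_apply (n : ℕ) (F : C_c(kernelGroupoid.Strings (n + 1), ℤ)) :
    kernelGroupoid.boundary n F = ∑ i : Fin (n + 2), (-1 : ℤ) ^ (i : ℕ) •
      pushforward (kernelGroupoid.face i) (kernelGroupoid.isLocalHomeomorph_face i) F := by
  change (kernelGroupoid.boundary n).hom F = _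
  rw [EtaleGroupoid.boundary, ModuleCat.hom_sum, LinearMap.sum_apply]
  rfl

/-- By functoriality, both sides are the push-forward of `m` along the same composite map from `X^∞`
to strings. The face zero uses `k = g₁⁻¹`, the other faces `k = 1`. -/
theorem pushforward_face_chainMap_single {n : ℕ} (i : Fin (n + 2)) (g : Fin (n + 1) → Dinf)
    (m m' : C_c(InfWord, ℤ)) (h : Fin n → Dinf) (k : Dinf) (hm : funRep k m = m')
    (H : ∀ x, kernelGroupoid.face i (stringOf g x) = stringOf h (act k x)) :
    pushforward (kernelGroupoid.face i) (kernelGroupoid.isLocalHomeomorph_face i)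
      (chainMap (n + 1) (Finsupp.single g m)) = chainMap n (Finsupp.single h m') := by
  subst hm
  have hl := (isLocalHomeomorph_stringOf h).comp (act k).isLocalHomeomorph
  have e1 := LinearMap.congr_fun (pushforward_comp (isLocalHomeomorph_stringOf g)
    (kernelGroupoid.isLocalHomeomorph_face i) hl (funext H)) m
  have e2 := LinearMap.congr_fun (pushforward_comp (act k).isLocalHomeomorph
    (isLocalHomeomorph_stringOf h) hl rfl) m
  rw [chainMap_single, chainMap_single]
  exact e1.trans e2.symm

theorem chainMap_comm (n : ℕ) (f : (Fin (n + 1) → Dinf) →₀ C_c(InfWord, ℤ)) :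
    kernelGroupoid.boundary n (chainMap (n + 1) f) =
      chainMap n (groupHomology.inhomogeneousChains.d (Rep.of funRep) n f) := by
  induction f using Finsupp.induction_linear with
  | zero => simp
  | add f f' h h' => simp only [map_add, h, h']
  | single g m =>
    have hd := groupHomology.inhomogeneousChains.d_single (A := Rep.of funRep) n g m
    rw [hd, boundary_apply, Fin.sum_univ_succ, map_add, map_sum]
    congr 1
    · rw [Fin.val_zero, pow_zero, one_smul]
      exact pushforward_face_chainMap_single 0 g m _ _ _ rfl (face_zero_stringOf g)
    · refine Finset.sum_congr rfl fun i _ => ?_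
      rw [Fin.val_succ, map_smul]
      congr 1
      refine pushforward_face_chainMap_single i.succ g m _ _ 1 (by rw [map_one]; rfl) fun x => ?_
      rw [face_succ_stringOf, map_one]
      rfl

/-- The complex of inhomogeneous chains is the complex of the kernel groupoid. -/
noncomputable def chainIso :
    groupHomology.inhomogeneousChains (Rep.of funRep) ≅ kernelGroupoid.chainComplex :=
  HomologicalComplex.Hom.isoOfComponents
    (fun n => (LinearEquiv.ofBijective (chainMap n) (chainMap_bijective n)).toModuleIso)
    (by
      rintro _ j rfl
      have h1 : (groupHomology.inhomogeneousChains (Rep.of funRep)).d (j + 1) j =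
        groupHomology.inhomogeneousChains.d (Rep.of funRep) j :=
          groupHomology.inhomogeneousChains.d_def _ j
      have h2 : kernelGroupoid.chainComplex.d (j + 1) j = kernelGroupoid.boundary j :=
        ChainComplex.of_d _ _ _
      rw [h1, h2]
      exact ModuleCat.hom_ext (LinearMap.ext fun f => chainMap_comm j f))

/-! ## Functions on the space of infinite words -/

/-- A function that is negated by a generator is a difference, if its support has a clopen
fundamental domain. -/
theorem exists_sub_funRep_eq {i : Gen} {f : C_c(InfWord, ℤ)} (hf : f + funRep (.of i) f = 0)
    {D : Set InfWord} (hD : IsClopen D) (h : ∀ x, f x ≠ 0 → (x ∈ D ↔ act (.of i) x ∉ D)) :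
    ∃ y, y - funRep (.of i) y = f := by
  classical
  have hneg : ∀ x, f (act (.of i) x) = - f x := fun x => by
    have := DFunLike.congr_fun hf x
    rw [CompactlySupportedContinuousMap.add_apply, funRep_apply, of_inv] at this
    change f x + _ = 0 at this
    omega
  -- The cut-off of `f` to the fundamental domain is continuous because `D` is clopen. Of `x` and `s
  -- x` exactly one lies in `D` whenever `f x ≠ 0`, and `f` changes sign under `s`.
  let y : C_c(InfWord, ℤ) :=
    { toFun := D.indicator f
      continuous_toFun := f.continuous.indicator (by simp [hD.frontier_eq])
      hasCompactSupport' := HasCompactSupport.of_compactSpace _ }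
  refine ⟨y, ?_⟩
  ext x
  have e : (y - funRep (.of i) y) x = D.indicator f x - D.indicator f (act (.of i) x) := by
    have := funRep_apply (.of i) y x
    rw [of_inv] at this
    exact congrArg (y x - ·) this
  rw [e]
  by_cases hx : f x = 0
  · have hx' : f (act (.of i) x) = 0 := by rw [hneg, hx, neg_zero]
    simp [Set.indicator_apply, hx, hx']
  · have := h x hx
    by_cases hxD : x ∈ D
    · rw [Set.indicator_of_mem hxD, Set.indicator_of_notMem (this.1 hxD), sub_zero]
    · have hbD : act (.of i) x ∈ D := by by_contra hcon; exact hxD (this.2 hcon)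
      rw [Set.indicator_of_notMem hxD, Set.indicator_of_mem hbD, hneg]
      ring

theorem isClopen_letter (n : ℕ) (c : Fin 2) : IsClopen {x : InfWord | x n = c} :=
  (isClopen_discrete {c}).preimage (continuous_apply n)

theorem act_a_head (x : InfWord) : act (.of .a) x 0 = 0 ↔ x 0 ≠ 0 := by
  rw [← consWord_head_tail x]
  obtain h | h : x 0 = 0 ∨ x 0 = 1 := by omega
  · rw [h, act_a_zero]; simp [consWord]
  · rw [h, act_a_one]; simp [consWord]

/-- The words of the form `1ᵏ 0 0 x` with `k < N`. -/
def fundDomain : ℕ → Set InfWord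
  | 0 => ∅
  | N + 1 => {x | x 0 = 0} ∩ {x | x 1 = 0} ∪ {x | x 0 = 1} ∩ dropWord 1 ⁻¹' fundDomain N

theorem isClopen_fundDomain (N : ℕ) : IsClopen (fundDomain N) := by
  induction N with
  | zero => exact isClopen_empty
  | succ N ih =>
    exact ((isClopen_letter 0 0).inter (isClopen_letter 1 0)).union
      ((isClopen_letter 0 1).inter (ih.preimage (continuous_dropWord 1)))

theorem dropWord_consWord (c : Fin 2) (x : InfWord) : dropWord 1 (consWord c x) = x :=
  dropWord_prepend [c] x

/-- On a word `1ᵏ 0 x` the generator `b` acts as `1ᵏ 0 (a x)`, so it flips the letter after the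
first `0`. The domain requires that letter to be `0`, with `k < N`. -/
theorem mem_fundDomain_iff {N : ℕ} {x : InfWord} (hx : ∃ j < N, x j ≠ 1) :
    x ∈ fundDomain N ↔ act (.of .b) x ∉ fundDomain N := by
  induction N generalizing x with
  | zero => obtain ⟨j, hj, -⟩ := hx; omega
  | succ N ih =>
    have h0 : ∀ y : InfWord, consWord 0 y ∈ fundDomain (N + 1) ↔ y 0 = 0 := fun y => by
      simp [fundDomain, consWord]
    have h1 : ∀ y : InfWord, consWord 1 y ∈ fundDomain (N + 1) ↔ y ∈ fundDomain N := fun y => by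
      simp [fundDomain, consWord, dropWord_consWord]
    obtain ⟨j, hj, hxj⟩ := hx
    obtain ⟨c, y, rfl⟩ : ∃ c y, x = consWord c y := ⟨_, _, (consWord_head_tail x).symm⟩
    obtain rfl | rfl : c = 0 ∨ c = 1 := by omega
    · rw [act_b_zero, h0, h0, act_a_head, not_not]
    · rw [act_b_one, h1, h1]
      cases j with
      | zero => exact absurd rfl hxj
      | succ j => exact ih ⟨j, by omega, hxj⟩

theorem act_b_ones : act (.of .b) (fun _ => 1) = fun _ => 1 := by
  have h : ∀ n, act (.of .b) (fun _ => 1) n = 1 := by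
    intro n
    induction n with
    | zero =>
      rw [← consWord_head_tail (fun _ => 1), act_b_one]; rfl
    | succ n ih =>
      rw [← consWord_head_tail (fun _ => 1), act_b_one]
      -- The tail of the constant word is again the constant word, by definition.
      exact ih
  exact funext h

theorem exists_prefix_ones {V : Set InfWord} (hV : IsOpen V) (h1 : (fun _ => 1) ∈ V) :
    ∃ N, ∀ x : InfWord, (∀ j < N, x j = 1) → x ∈ V := by
  obtain ⟨I, u, hu, hsub⟩ := isOpen_pi_iff.1 hV _ h1
  refine ⟨I.sup id + 1, fun x hx => hsub fun i hi => ?_⟩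
  rw [hx i (Nat.lt_succ_of_le (Finset.le_sup (f := id) hi))]
  exact (hu i hi).2

/-- This is the vanishing of the even homology of `{1, s}` with coefficients in `C(X^∞, ℤ)`. A fixed
point of `s` is harmless because `ℤ` has no element of order two. -/
theorem exists_sub_funRep_eq_of_add_eq_zero (i : Gen) {f : C_c(InfWord, ℤ)}
    (hf : f + funRep (.of i) f = 0) : ∃ y, y - funRep (.of i) y = f := by
  cases i with
  | a =>
    refine exists_sub_funRep_eq hf (isClopen_letter 0 0) fun x _ => ?_
    rw [Set.mem_ofPred_eq, Set.mem_ofPred_eq, act_a_head, not_not]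
  | b =>
    -- At the fixed point the hypothesis reads `2 f = 0`. Local constancy then makes `f` vanish on a
    -- cylinder `Z(1ᴺ)`, and `fundDomain N` serves for the complement.
    have h1 : f (fun _ => 1) = 0 := by
      have := DFunLike.congr_fun hf (fun _ => 1)
      rw [CompactlySupportedContinuousMap.add_apply, funRep_apply, of_inv, act_b_ones] at this
      change f _ + f _ = 0 at this
      omega
    obtain ⟨N, hN⟩ := exists_prefix_ones
      (V := f ⁻¹' {0}) ((isOpen_discrete _).preimage f.continuous) h1
    refine exists_sub_funRep_eq hf (isClopen_fundDomain N) fun x hx => mem_fundDomain_iff ?_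
    by_contra hcon
    push Not at hcon
    exact hx (hN x hcon)

/-! ### Vanishing in even degrees and torsion in odd degrees. -/

theorem groupHomology_even (n : ℕ) (hn : Even n) (z : groupHomology (Rep.of funRep) (n + 2)) :
    z = 0 := by
  rw [← one_nsmul z]
  refine nsmul_groupHomology_eq_zero _ n 1 (fun i x hx => ?_) z
  -- For even `n`, cycles satisfy `x + s x = 0` and boundaries have the form `y - s y`.
  rw [hn.neg_one_pow, one_smul] at hx
  rw [hn.neg_one_pow, one_nsmul]
  obtain ⟨y, hy⟩ := exists_sub_funRep_eq_of_add_eq_zero i hx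
  exact ⟨y, by rw [one_smul]; exact hy⟩

/-- Here cycles are the `s`-invariant elements, and an invariant `x` serves as its own witness: `x +
s x = 2 x`. Nothing about the coefficients is used. -/
theorem groupHomology_odd (n : ℕ) (hn : Odd n) (z : groupHomology (Rep.of funRep) (n + 2)) :
    2 • z = 0 := by
  refine nsmul_groupHomology_eq_zero _ n 2 (fun i x hx => ⟨x, ?_⟩) z
  rw [hn.neg_one_pow, neg_smul, one_smul, ← sub_eq_add_neg, sub_eq_zero] at hx
  rw [hn.neg_one_pow, neg_smul, one_smul, sub_neg_eq_add, ← hx, two_nsmul]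

end DihedralGroupoid

theorem mainTheorem8 (n : ℕ) (hn : 1 ≤ n) :
    Subsingleton (DihedralGroupoid.kernelGroupoid.homology (2 * n)) ∧
      IsAddTorsion (DihedralGroupoid.kernelGroupoid.homology (2 * n + 1)) := by
  let e := fun m => HomologicalComplex.homologyMapIso DihedralGroupoid.chainIso m
  have hinj : ∀ m, Function.Injective (e m).inv := fun m =>
    (ModuleCat.mono_iff_injective _).1 inferInstance
  -- The degrees become `2 k + 2` and `(2 k + 1) + 2`, in the range where the resolution is
  -- periodic.
  obtain ⟨k, rfl⟩ : ∃ k, n = k + 1 := ⟨n - 1, by omega⟩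
  constructor
  · refine ⟨fun x y => hinj _ ?_⟩
    exact (DihedralGroupoid.groupHomology_even (2 * k) (even_two_mul k) _).trans
      (DihedralGroupoid.groupHomology_even (2 * k) (even_two_mul k) _).symm
  · intro z
    refine isOfFinAddOrder_iff_nsmul_eq_zero.2 ⟨2, two_pos, hinj _ ?_⟩
    rw [map_nsmul, map_zero]
    exact DihedralGroupoid.groupHomology_odd (2 * k + 1) (odd_two_mul_add_one k) _
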